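/- Let $D$ be an oriented link diagram with $l$ ordered components $D_1,\dots,D_l$ and at least one crossing, i.e. a smooth immersion of $l$ disjoint oriented circles into the plane $\mathbb{R}^2$ whose only singularities are finitely many transverse double points (the crossings $x$), each with over/under information. Regard $D$ as a diagram on $\mathbb{R}^2$, or on the sphere $S^2=\mathbb{R}^2\cup\{\infty\}$ (with $\infty\notin D$). Its regions $R$ are the connected components of the complement of its image; $R_\infty$ is the unbounded region, respectively the region containing $\infty$. Set $a^{(a1)}_{xR}=1$ if $R$ touches $x$ at a corner through which one turns counterclockwise from the underpass to the overpass, $a^{(a1)}_{xR}=-1$ if $R$ touches $x$ at a corner through which one turns clockwise from the underpass to the overpass, and $a^{(a1)}_{xR}=0$ if $R$ does not touch $x$. Set $a^{(a2)}_{xR}=2a^{(a1)}_{xR}$ if $R$ touches $x$ at two opposite corners, and $a^{(a2)}_{xR}=a^{(a1)}_{xR}$ otherwise. Let $\Phi_{a2}(D):\mathbb{Z}^{\{\text{regions}\}}\to\mathbb{Z}^{\{\text{crossings}\}}$ be the homomorphism with matrix $\bigl(a^{(a2)}_{xR}\bigr)$ (alternating region choice, double counting rule). An Alexander numbering of an oriented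 diagram assigns an integer to each of its regions so that along every oriented arc the number on the left is larger by one than the number on the right. For each $i$ there is exactly one vector $\mathbf{u}_i\in\mathbb{Z}^{\{\text{regions of }D\}}$ such that $\mathbf{u}_i$ is $0$ on $R_\infty$ and, for some Alexander numbering $a$ of the diagram $D_i$ alone, the entry of $\mathbf{u}_i$ at each region $R$ of $D$ is $a_S$, where $S$ is the region of $D_i$ that contains $R$. Let $\mathbf{u}_\infty$ be the vector with all entries $1$. Then $\mathbf{u}_1,\dots,\mathbf{u}_l,\mathbf{u}_\infty$ lie in $\ker\Phi_{a2}(D)$ and form a $\mathbb{Z}$-basis of $\ker\Phi_{a2}(D)$. -/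

import Mathlib

open scoped Topology ContDiff

/-- An oriented link diagram with `l` ordered link components. The underlying closed `1`-manifold
is `Fin l × UnitAddCircle` (that is, `l` disjoint oriented circles `ℝ / ℤ`) and the plane is `ℂ`.
The diagram is a smooth immersion of it into the plane whose only singularities are transverse
double points, with over/under information at each double point. -/
structure LinkDiagram (l : ℕ) where
  /-- The projection of the `i`-th link component. -/
  curve : Fin l → UnitAddCircle → ℂ
  smooth : ∀ i, ContDiff ℝ ∞ (fun t : ℝ => curve i (t : UnitAddCircle))
  immersed : ∀ i (θ : UnitAddCircle),
    deriv (fun t : ℝ => curve i (θ + (t : UnitAddCircle))) 0 ≠ 0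
  /-- Two distinct points of the link with the same image have non-parallel velocities. -/
  transverse : ∀ α β : Fin l × UnitAddCircle, α ≠ β → curve α.1 α.2 = curve β.1 β.2 →
    LinearIndependent ℝ
      ![deriv (fun t : ℝ => curve α.1 (α.2 + (t : UnitAddCircle))) 0,
        deriv (fun t : ℝ => curve β.1 (β.2 + (t : UnitAddCircle))) 0]
  /-- There are no triple points. -/
  double : ∀ α β γ : Fin l × UnitAddCircle, curve α.1 α.2 = curve β.1 β.2 →
    curve β.1 β.2 = curve γ.1 γ.2 → α = β ∨ β = γ ∨ α = γ
  /-- The over/under information: the points of the link that lie on an overpass. (Only the points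
  over a double point matter.) -/
  overSet : Set (Fin l × UnitAddCircle)
  over_under : ∀ α β : Fin l × UnitAddCircle, α ≠ β → curve α.1 α.2 = curve β.1 β.2 →
    (α ∈ overSet ↔ β ∉ overSet)

namespace LinkDiagram

variable {l : ℕ} {X : Type*} [TopologicalSpace X]

/-- The image in the plane of a point of the link. -/
def point (D : LinkDiagram l) (α : Fin l × UnitAddCircle) : ℂ := D.curve α.1 α.2

/-- The velocity vector of the diagram at a point of the link. -/
noncomputable def velocity (D : LinkDiagram l) (α : Fin l × UnitAddCircle) : ℂ :=
  deriv (fun t : ℝ => D.curve α.1 (α.2 + (t : UnitAddCircle))) 0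

/-- The projection image of the link. -/
def image (D : LinkDiagram l) : Set ℂ := Set.range D.point

/-- The sub-diagram representing the `i`-th link component, all the others being ignored. -/
def component (D : LinkDiagram l) (i : Fin l) : LinkDiagram 1 where
  curve _ := D.curve i
  smooth _ := D.smooth i
  immersed _ := D.immersed i
  transverse α β h e := D.transverse (i, α.2) (i, β.2)
    (fun h' => h (Prod.ext (Subsingleton.elim _ _) (Prod.ext_iff.1 h').2)) e
  double α β γ e e' := by
    rcases D.double (i, α.2) (i, β.2) (i, γ.2) e e' with h | h | h
    · exact Or.inl (Prod.ext (Subsingleton.elim _ _) (Prod.ext_iff.1 h).2)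
    · exact Or.inr (Or.inl (Prod.ext (Subsingleton.elim _ _) (Prod.ext_iff.1 h).2))
    · exact Or.inr (Or.inr (Prod.ext (Subsingleton.elim _ _) (Prod.ext_iff.1 h).2))
  overSet := {α | (i, α.2) ∈ D.overSet}
  over_under α β h e := D.over_under (i, α.2) (i, β.2)
    (fun h' => h (Prod.ext (Subsingleton.elim _ _) (Prod.ext_iff.1 h').2)) e

/-- A crossing, given by its overpass point and its underpass point. (As there are no triple
points, this is the same as a double point of the projection image.) -/
structure Crossing (D : LinkDiagram l) where
  overPt : Fin l × UnitAddCircle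
  underPt : Fin l × UnitAddCircle
  overPt_mem : overPt ∈ D.overSet
  underPt_notMem : underPt ∉ D.overSet
  point_eq : D.point overPt = D.point underPt

/-- The regions of the diagram on the surface `X`, into which the plane is placed by `ι`: the
connected components of the complement of the projection image. Below, `ι` is the identity of the
plane `ℂ` or the inclusion of the plane into the sphere `OnePoint ℂ = ℂ ∪ {∞}`. -/
def Region (D : LinkDiagram l) (ι : ℂ → X) : Type _ :=
  {R : Set X // ∃ p ∈ (ι '' D.image)ᶜ, R = connectedComponentIn (ι '' D.image)ᶜ p}

/-- The region `R` lies next to the point `z` of the diagram in the direction `v`. -/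
def Touches (D : LinkDiagram l) (ι : ℂ → X) (z v : ℂ) (R : D.Region ι) : Prop :=
  ∀ᶠ ε : ℝ in 𝓝[>] 0, ι (z + (ε : ℂ) * v) ∈ R.1

/-! ### Alexander numberings -/

/-- An Alexander numbering: along every oriented arc, the index of the region on the left is
larger by one than that of the region on the right. -/
def IsAlexanderNumbering (D : LinkDiagram l) (ι : ℂ → X) (a : D.Region ι → ℤ) : Prop :=
  ∀ α : Fin l × UnitAddCircle, (∀ β, D.point β = D.point α → β = α) →
    ∀ L R : D.Region ι,
      D.Touches ι (D.point α) (Complex.I * D.velocity α) L →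
      D.Touches ι (D.point α) (-(Complex.I * D.velocity α)) R →
      a L = a R + 1

/-- A componentwise Alexander numbering associated with the `i`-th component: every region of `D`
gets the index, in some Alexander numbering of the sub-diagram of the `i`-th component, of the
region of this sub-diagram that contains it. -/
def IsComponentwiseAlexander (D : LinkDiagram l) (ι : ℂ → X) (i : Fin l)
    (u : D.Region ι → ℤ) : Prop :=
  ∃ a : (D.component i).Region ι → ℤ, (D.component i).IsAlexanderNumbering ι a ∧
    ∀ (R : D.Region ι) (S : (D.component i).Region ι), R.1 ⊆ S.1 → u R = a S

/-- The standard kernel solution associated with the `i`-th component: the componentwise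
Alexander numbering that is `0` on the region `Rinf`. -/
def IsStandardKernelSolution (D : LinkDiagram l) (ι : ℂ → X) (Rinf : D.Region ι) (i : Fin l)
    (u : D.Region ι → ℤ) : Prop :=
  D.IsComponentwiseAlexander ι i u ∧ u Rinf = 0

/-! ### The alternating region choice matrix of the double counting rule -/

/-- The direction in which a corner of a crossing is entered from the crossing. The corner
`c = (σ, τ)`, with signs `σ` and `τ`, is the one between the half `σ • v` of the overpass and the
half `τ • w` of the underpass, where `v` and `w` are the velocities. -/
noncomputable def cornerDir (D : LinkDiagram l) (x : D.Crossing) (c : ℤˣ × ℤˣ) : ℂ :=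
  ((c.1 : ℤ) : ℂ) * D.velocity x.overPt + ((c.2 : ℤ) : ℂ) * D.velocity x.underPt

/-- The region `R` touches the crossing `x` at the corner `c`. -/
def TouchesCorner (D : LinkDiagram l) (ι : ℂ → X) (x : D.Crossing) (c : ℤˣ × ℤˣ)
    (R : D.Region ι) : Prop :=
  D.Touches ι (D.point x.overPt) (D.cornerDir x c) R

/-- The corner `c` of `x` is contained by the underpass and the overpass counterclockwise: turning
counterclockwise through the corner leads from the underpass `τ • w` to the overpass `σ • v`, that
is, the determinant of `(τ • w, σ • v)` is positive. -/
def PosCorner (D : LinkDiagram l) (x : D.Crossing) (c : ℤˣ × ℤˣ) : Prop :=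
  0 < (star (((c.2 : ℤ) : ℂ) * D.velocity x.underPt) *
    (((c.1 : ℤ) : ℂ) * D.velocity x.overPt)).im

open Classical in
/-- The alternating region choice matrix of the single counting rule. -/
noncomputable def matrixA1 (D : LinkDiagram l) (ι : ℂ → X) : Matrix D.Crossing (D.Region ι) ℤ :=
  Matrix.of fun x R =>
    if ∃ c, D.PosCorner x c ∧ D.TouchesCorner ι x c R then 1
    else if ∃ c, ¬ D.PosCorner x c ∧ D.TouchesCorner ι x c R then -1
    else 0

open Classical in
/-- The alternating region choice matrix of the double counting rule: the entry is doubled if the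
region touches the crossing twice, at two opposite corners. -/
noncomputable def matrixA2 (D : LinkDiagram l) (ι : ℂ → X) : Matrix D.Crossing (D.Region ι) ℤ :=
  Matrix.of fun x R =>
    if ∃ c, D.TouchesCorner ι x c R ∧ D.TouchesCorner ι x (-c) R then 2 * D.matrixA1 ι x R
    else D.matrixA1 ι x R

/-- At most one region lies next to a point in a given direction. -/
theorem Touches.unique (D : LinkDiagram l) (ι : ℂ → X) {z v : ℂ} {R S : D.Region ι}
    (hR : D.Touches ι z v R) (hS : D.Touches ι z v S) : R = S := by
  obtain ⟨ε, h1, h2⟩ := (Filter.Eventually.and hR hS).exists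
  obtain ⟨R, p, _, rfl⟩ := R
  obtain ⟨S, q, _, rfl⟩ := S
  exact Subtype.ext ((connectedComponentIn_eq h1).trans (connectedComponentIn_eq h2).symm)

/-- Each row of the matrix has finitely many non-zero entries. -/
theorem matrixA2_support (D : LinkDiagram l) (ι : ℂ → X) (x : D.Crossing) (u : D.Region ι → ℤ) :
    (Function.support fun R => D.matrixA2 ι x R * u R).Finite := by
  have hfin : (⋃ c : ℤˣ × ℤˣ, {R | D.TouchesCorner ι x c R}).Finite :=
    Set.finite_iUnion fun c => Set.Subsingleton.finite fun R hR S hS => Touches.unique D ι hR hS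
  refine hfin.subset fun R hR => ?_
  by_contra hno
  have hno' : ∀ c, ¬ D.TouchesCorner ι x c R := by simpa using hno
  apply hR
  simp [matrixA2, matrixA1, hno']

/-- The homomorphism `Φ_{a2}(D)` with representation matrix `A_{a2}(D)`. Each row of the matrix
has finitely many non-zero entries, so that the sum is a finite sum. -/
noncomputable def Phi (D : LinkDiagram l) (ι : ℂ → X) :
    (D.Region ι → ℤ) →ₗ[ℤ] (D.Crossing → ℤ) where
  toFun u x := ∑ᶠ R, D.matrixA2 ι x R * u R
  map_add' u v := by
    funext x
    simp only [Pi.add_apply, mul_add]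
    exact finsum_add_distrib (D.matrixA2_support ι x u) (D.matrixA2_support ι x v)
  map_smul' k u := by
    funext x
    simp only [Pi.smul_apply, smul_eq_mul, RingHom.id_apply]
    refine Eq.trans (finsum_congr fun R => ?_) (mul_finsum _ k).symm
    ring

end LinkDiagram

/-! The winding number of the `i`-th component jumps by one across that component and by zero across
the others (`tendsto_windingNumber_sub`, `windingFun_jump`). It vanishes near infinity, so it is the
standard kernel solution: the difference of two Alexander numberings of one component has no jumps,
hence is constant (`isStandardKernelSolution_iff`).

The same jump shows that adjacent corners of a crossing lie in different regions. Only opposite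
corners can coincide; they carry equal signs, and double counting makes every row of the matrix the
alternating sum over the four corners (`matrixA2_apply`). The kernel equation then says exactly that
the jump of `u` across a strand is the same before and after the crossing (`phi_apply_eq_zero_iff`).
Thus a kernel element has a constant jump `d i` along each component (`exists_jump`). Subtracting `∑
d i * w i`, with `w i` the winding numbers, leaves a function without jumps, which is constant
(`eq_of_forall_touches`); this gives spanning. Reading off jumps gives linear independence.

The local picture of sides and corners comes from the inverse function theorem applied to the sum of
two transverse curves (`nonempty_chart`). The plane and the sphere are treated together through
`PlaneEmbedding`. -/

open Filter Set

/-! ### Winding numbers of closed curves -/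

/-- The winding number of a curve of period `1` about a point of the plane. -/
noncomputable def windingNumber (γ : ℝ → ℂ) (z : ℂ) : ℂ :=
  (2 * Real.pi * Complex.I)⁻¹ * ∫ t in (0 : ℝ)..1, deriv γ t / (γ t - z)

/-- Dominated convergence: near `z₀` the distance to the compact piece stays at least `δ / 2`. Since
only the piece over `[a, b]` has to avoid `z₀`, this also applies when `z₀` lies elsewhere on the
curve. -/
theorem continuousAt_integral_div_sub {γ g : ℝ → ℂ} (hγ : Continuous γ) (hg : Continuous g)
    {a b : ℝ} {z₀ : ℂ} (hz : z₀ ∉ γ '' uIcc a b) :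
    ContinuousAt (fun z => ∫ t in a..b, g t / (γ t - z)) z₀ := by
  have hK : IsClosed (γ '' uIcc a b) := (isCompact_uIcc.image hγ).isClosed
  obtain ⟨δ, hδ, hball⟩ := Metric.isOpen_iff.1 hK.isOpen_compl z₀ hz
  obtain ⟨M, hM⟩ := isCompact_uIcc.exists_bound_of_continuousOn (s := uIcc a b) hg.continuousOn
  have key : ∀ z ∈ Metric.ball z₀ (δ / 2), ∀ t ∈ uIcc a b, δ / 2 ≤ ‖γ t - z‖ := by
    intro z hz t ht
    have h1 : δ ≤ dist (γ t) z₀ := by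
      by_contra! h
      exact hball h ⟨t, ht, rfl⟩
    have h2 : dist (γ t) z₀ ≤ dist (γ t) z + dist z z₀ := dist_triangle _ _ _
    have h3 : dist z z₀ < δ / 2 := hz
    rw [← dist_eq_norm]
    linarith
  refine intervalIntegral.continuousAt_of_dominated_interval (bound := fun _ => M / (δ / 2))
    ?_ ?_ ?_ ?_
  · exact Eventually.of_forall fun z => (by fun_prop : Measurable _).aestronglyMeasurable
  · filter_upwards [Metric.ball_mem_nhds z₀ (half_pos hδ)] with z hz
    refine Eventually.of_forall fun t ht => ?_
    have ht' := uIoc_subset_uIcc ht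
    rw [norm_div]
    exact div_le_div₀ ((norm_nonneg _).trans (hM t ht')) (hM t ht') (half_pos hδ)
      (key z hz t ht')
  · exact intervalIntegrable_const
  · refine Eventually.of_forall fun t ht => ?_
    have ht' := uIoc_subset_uIcc ht
    have : γ t - z₀ ≠ 0 := by
      have := key z₀ (Metric.mem_ball_self (half_pos hδ)) t ht'
      rw [← norm_pos_iff]
      linarith
    fun_prop (disch := assumption)

theorem tendsto_integral_div_sub_cocompact {γ g : ℝ → ℂ} (hγ : Continuous γ) (hg : Continuous g)
    (a b : ℝ) :
    Tendsto (fun z => ∫ t in a..b, g t / (γ t - z)) (cocompact ℂ) (𝓝 0) := by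
  obtain ⟨M, hM⟩ := isCompact_uIcc.exists_bound_of_continuousOn (s := uIcc a b) hg.continuousOn
  obtain ⟨C, hC⟩ := isCompact_uIcc.exists_bound_of_continuousOn (s := uIcc a b) hγ.continuousOn
  have hM0 : 0 ≤ M := (norm_nonneg _).trans (hM a left_mem_uIcc)
  have hlim : Tendsto (fun z : ℂ => M / (‖z‖ - C) * |b - a|) (cocompact ℂ) (𝓝 0) := by
    have h1 : Tendsto (fun z : ℂ => ‖z‖ - C) (cocompact ℂ) atTop :=
      tendsto_atTop_add_const_right _ _ (tendsto_norm_cocompact_atTop)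
    simpa using (tendsto_const_nhds.div_atTop h1).mul_const (|b - a|)
  refine squeeze_zero_norm' ?_ hlim
  filter_upwards [(tendsto_norm_cocompact_atTop (E := ℂ)).eventually_gt_atTop C] with z hz
  refine intervalIntegral.norm_integral_le_of_norm_le_const fun t ht => ?_
  have ht' := uIoc_subset_uIcc ht
  rw [norm_div]
  refine div_le_div₀ hM0 (hM t ht') (by linarith) ?_
  have := norm_sub_norm_le z (γ t)
  rw [norm_sub_rev] at this
  linarith [hC t ht']

/-- With `G` the partial integral, `exp (-G) * (γ - z)` has derivative zero. Comparing its values at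
the two ends of the closed curve gives `exp (-G 1) = 1`. -/
theorem exists_int_windingNumber {γ : ℝ → ℂ} (hγ : ContDiff ℝ 1 γ) (hper : γ 1 = γ 0) {z : ℂ}
    (hz : z ∉ range γ) : ∃ n : ℤ, windingNumber γ z = n := by
  have hne : ∀ t, γ t - z ≠ 0 := fun t h => hz ⟨t, sub_eq_zero.1 h⟩
  have hcont : Continuous fun t => deriv γ t / (γ t - z) := by
    have h1 : Continuous (deriv γ) := hγ.continuous_deriv le_rfl
    have h2 := hγ.continuous
    exact h1.div (by fun_prop) hne
  set G : ℝ → ℂ := fun s => ∫ t in (0 : ℝ)..s, deriv γ t / (γ t - z) with hG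
  have hGd : ∀ s, HasDerivAt G (deriv γ s / (γ s - z)) s := fun s =>
    intervalIntegral.integral_hasDerivAt_right (hcont.intervalIntegrable _ _)
      (hcont.stronglyMeasurableAtFilter _ _) hcont.continuousAt
  have hd : ∀ s, HasDerivAt (fun s => Complex.exp (-G s) * (γ s - z)) 0 s := by
    intro s
    have h1 := ((hGd s).neg.cexp).mul (((hγ.differentiable one_ne_zero s).hasDerivAt).sub_const z)
    convert! h1 using 1
    field_simp [hne s]
    ring
  have hconst := is_const_of_deriv_eq_zero (fun s => (hd s).differentiableAt)
    (fun s => (hd s).deriv) 1 0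
  have hG0 : G 0 = 0 := by simp [hG]
  rw [hper, hG0, neg_zero, Complex.exp_zero] at hconst
  have hexp : Complex.exp (-G 1) = 1 := mul_right_cancel₀ (hne 0) hconst
  obtain ⟨n, hn⟩ := Complex.exp_eq_one_iff.1 hexp
  refine ⟨-n, ?_⟩
  have : G 1 = -n * (2 * Real.pi * Complex.I) := by linear_combination -hn
  have hpi : (2 * Real.pi * Complex.I : ℂ) ≠ 0 := Complex.two_pi_I_ne_zero
  change (2 * Real.pi * Complex.I)⁻¹ * G 1 = _
  rw [this]
  push_cast
  field_simp

theorem continuousAt_windingNumber {γ : ℝ → ℂ} (hγ : ContDiff ℝ 1 γ) {z : ℂ}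
    (hz : z ∉ range γ) : ContinuousAt (windingNumber γ) z :=
  continuousAt_const.mul (continuousAt_integral_div_sub hγ.continuous
    (hγ.continuous_deriv le_rfl) fun h => hz (image_subset_range _ _ h))

theorem tendsto_windingNumber_cocompact {γ : ℝ → ℂ} (hγ : ContDiff ℝ 1 γ) :
    Tendsto (windingNumber γ) (cocompact ℂ) (𝓝 0) := by
  have h := (tendsto_integral_div_sub_cocompact hγ.continuous
    (hγ.continuous_deriv le_rfl) 0 1).const_mul ((2 * Real.pi * Complex.I : ℂ)⁻¹)
  rwa [mul_zero] at h

/-- The integral over a piece of a curve, seen from a point that is separated from the piece by a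
branch cut of a rotated logarithm. -/
theorem integral_div_sub_eq_log {γ : ℝ → ℂ} (hγ : ContDiff ℝ 1 γ) {a b : ℝ} {z c : ℂ}
    (hc : c ≠ 0) (h : ∀ t ∈ uIcc a b, c * (γ t - z) ∈ Complex.slitPlane) :
    ∫ t in a..b, deriv γ t / (γ t - z) =
      Complex.log (c * (γ b - z)) - Complex.log (c * (γ a - z)) := by
  have hne : ∀ t ∈ uIcc a b, γ t - z ≠ 0 := fun t ht h0 => by
    have := h t ht
    rw [h0, mul_zero] at this
    exact Complex.slitPlane_ne_zero this rfl
  refine intervalIntegral.integral_eq_sub_of_hasDerivAt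
    (f := fun t => Complex.log (c * (γ t - z))) (fun t ht => ?_) ?_
  · have h1 := ((((hγ.differentiable one_ne_zero t).hasDerivAt).sub_const z).const_mul c).clog_real
      (h t ht)
    convert! h1 using 1
    rw [mul_div_mul_left _ _ hc]
  · refine ContinuousOn.intervalIntegrable ?_
    exact (hγ.continuous_deriv le_rfl).continuousOn.div
      (hγ.continuous.continuousOn.sub continuousOn_const) hne


theorem log_sub_log_neg_of_im_pos {A : ℂ} (hA : 0 < A.im) :
    Complex.log A - Complex.log (-A) = Real.pi * Complex.I := by
  simp only [Complex.log, norm_neg, Complex.arg_neg_eq_arg_sub_pi_of_im_pos hA]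
  push_cast
  ring

/-- Divided by its initial velocity, the curve is locally a graph over the real axis. Hence it meets
the imaginary axis only at parameter `0`, which keeps it off the branch cuts used below. -/
theorem exists_re_strictMono {γ : ℝ → ℂ} (hγ : ContDiff ℝ 1 γ) (h0 : deriv γ 0 ≠ 0) :
    ∃ η : ℝ, 0 < η ∧ η < 1 / 2 ∧
      StrictMonoOn (fun t => ((γ t - γ 0) / deriv γ 0).re) (Icc (-η) η) := by
  have hd : ∀ t, HasDerivAt (fun t => ((γ t - γ 0) / deriv γ 0).re)
      (deriv γ t / deriv γ 0).re t := fun t =>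
    Complex.reCLM.hasFDerivAt.comp_hasDerivAt t
      ((((hγ.differentiable one_ne_zero t).hasDerivAt).sub_const (γ 0)).div_const (deriv γ 0))
  have hc : Continuous fun t => (deriv γ t / deriv γ 0).re := by
    have := hγ.continuous_deriv le_rfl
    fun_prop
  have hpos : ∀ᶠ t in 𝓝 (0 : ℝ), 0 < (deriv γ t / deriv γ 0).re :=
    hc.continuousAt.eventually (lt_mem_nhds (by simp [div_self h0]))
  obtain ⟨δ, hδ, hball⟩ := Metric.eventually_nhds_iff.1 hpos
  refine ⟨min (δ / 2) (1 / 4), by positivity, (min_le_right _ _).trans_lt (by norm_num), ?_⟩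
  refine strictMonoOn_of_deriv_pos (convex_Icc _ _)
    (fun t _ => (hd t).continuousAt.continuousWithinAt) fun t ht => ?_
  rw [interior_Icc] at ht
  rw [(hd t).deriv]
  refine hball ?_
  rw [Real.dist_eq, sub_zero, abs_lt]
  have := min_le_left (δ / 2) (1 / 4)
  constructor <;> linarith [ht.1, ht.2]

/-- The integral is split into a short piece through `γ 0` and the rest. The rest is continuous at
`γ 0` and cancels in the limit; the short piece is a difference of rotated logarithms, with a
different branch on each side of the curve. -/
theorem tendsto_windingNumber_sub {γ : ℝ → ℂ} (hγ : ContDiff ℝ 1 γ)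
    (hper : Function.Periodic γ 1) (h0 : deriv γ 0 ≠ 0)
    (hinj : ∀ t, γ t = γ 0 → ∃ n : ℤ, t = n) :
    Tendsto (fun h : ℝ => windingNumber γ (γ 0 + h * (Complex.I * deriv γ 0)) -
      windingNumber γ (γ 0 + h * -(Complex.I * deriv γ 0))) (𝓝[>] 0) (𝓝 1) := by
  obtain ⟨η, hη, hη2, hmono⟩ := exists_re_strictMono hγ h0
  set v := deriv γ 0 with hv
  set ζ : ℝ → ℂ := fun t => (γ t - γ 0) / v with hζ
  have hζ0 : ζ 0 = 0 := by simp [hζ]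
  have m0 : (0 : ℝ) ∈ Icc (-η) η := ⟨by linarith, hη.le⟩
  have hre : ∀ t ∈ Icc (-η) η, t ≠ 0 → (ζ t).re ≠ 0 := by
    intro t ht ht0 h
    refine ht0 (hmono.injOn ht m0 ?_)
    simpa [hζ] using h
  have hA : 0 < (ζ η).re := by simpa [hζ] using hmono m0 ⟨by linarith, le_rfl⟩ hη
  have hB : (ζ (-η)).re < 0 := by
    simpa [hζ] using hmono ⟨le_rfl, by linarith⟩ m0 (by linarith : -η < 0)
  have hγd := hγ.continuous_deriv le_rfl
  have hdper : Function.Periodic (deriv γ) 1 := fun t => by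
    rw [← deriv_comp_add_const]
    exact congrArg (fun f => deriv f t) (funext hper)
  -- the two halves of the integral
  set J : ℂ → ℂ := fun z => ∫ t in -η..η, deriv γ t / (γ t - z) with hJ
  set K : ℂ → ℂ := fun z => ∫ t in η..(1 - η), deriv γ t / (γ t - z) with hK
  have hsplit : ∀ z ∉ range γ, windingNumber γ z = (2 * Real.pi * Complex.I)⁻¹ * (J z + K z) := by
    intro z hz
    have hcont : Continuous fun t => deriv γ t / (γ t - z) :=
      hγd.div (hγ.continuous.sub continuous_const) fun t h => hz ⟨t, sub_eq_zero.1 h⟩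
    have hp : Function.Periodic (fun t => deriv γ t / (γ t - z)) 1 := fun t => by
      simp only [hper t, hdper t]
    rw [windingNumber, hJ, hK]
    congr 1
    simp only
    rw [intervalIntegral.integral_add_adjacent_intervals (hcont.intervalIntegrable _ _)
      (hcont.intervalIntegrable _ _)]
    have := hp.intervalIntegral_add_eq 0 (-η)
    rw [zero_add] at this
    rw [this]
    congr 1
    ring
  have hKc : ContinuousAt K (γ 0) := by
    refine continuousAt_integral_div_sub hγ.continuous hγd ?_
    rintro ⟨t, ht, hte⟩
    rw [uIcc_of_le (by linarith)] at ht
    obtain ⟨n, rfl⟩ := hinj t hte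
    have h1 : (0 : ℝ) < n := by linarith [ht.1]
    have h2 : (n : ℝ) < 1 := by linarith [ht.2]
    norm_cast at h1 h2
    omega
  -- At `t = 0` the value is `h > 0`; elsewhere its imaginary part is `± (ζ t).re`, which is
  -- nonzero.
  have slit : ∀ (c : ℂ) (h : ℝ), 0 < h → (c = Complex.I ∨ c = -Complex.I) →
      ∀ t ∈ Icc (-η) η, c * ζ t + h ∈ Complex.slitPlane := by
    intro c h hh hc t ht
    rw [Complex.mem_slitPlane_iff]
    rcases eq_or_ne t 0 with rfl | ht0
    · left; simp [hζ0, hh]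
    · right
      have := hre t ht ht0
      rcases hc with rfl | rfl <;> simpa using this
  have hJval : ∀ (c : ℂ) (h : ℝ), 0 < h → (c = Complex.I ∨ c = -Complex.I) →
      γ 0 + h * (c * v) ∉ γ '' Icc (-η) η ∧ J (γ 0 + h * (c * v)) =
        Complex.log (c * ζ η + h) - Complex.log (c * ζ (-η) + h) := by
    intro c h hh hc
    have hcc : c * c = -1 := by rcases hc with rfl | rfl <;> simp
    have hc0 : c ≠ 0 := by rcases hc with rfl | rfl <;> simp
    have hcalc : ∀ t, c / v * (γ t - (γ 0 + h * (c * v))) = c * ζ t + h := by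
      intro t
      have e1 : γ t = γ 0 + v * ζ t := by
        rw [hζ]; simp only; rw [mul_div_cancel₀ _ h0]; ring
      rw [e1]
      field_simp
      linear_combination (-h * v : ℂ) * hcc
    have hsl : ∀ t ∈ uIcc (-η) η,
        c / v * (γ t - (γ 0 + h * (c * v))) ∈ Complex.slitPlane := by
      intro t ht
      rw [uIcc_of_le (by linarith)] at ht
      rw [hcalc]
      exact slit c h hh hc t ht
    constructor
    · rintro ⟨t, ht, hte⟩
      have := hsl t (by rwa [uIcc_of_le (by linarith)])
      rw [hte, sub_self, mul_zero] at this
      exact Complex.slitPlane_ne_zero this rfl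
    · rw [hJ]
      simp only
      rw [integral_div_sub_eq_log hγ (div_ne_zero hc0 h0) hsl, hcalc, hcalc]
  have hpath : ∀ c : ℂ, Tendsto (fun h : ℝ => γ 0 + h * (c * v)) (𝓝[>] 0) (𝓝 (γ 0)) := by
    intro c
    have : Continuous fun h : ℝ => γ 0 + h * (c * v) := by fun_prop
    simpa using (this.tendsto 0).mono_left nhdsWithin_le_nhds
  have hoff : ∀ c : ℂ, (c = Complex.I ∨ c = -Complex.I) →
      ∀ᶠ h : ℝ in 𝓝[>] 0, γ 0 + h * (c * v) ∉ range γ := by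
    intro c hc
    have hcl : IsClosed (γ '' Icc η (1 - η)) := (isCompact_Icc.image hγ.continuous).isClosed
    have hn : γ 0 ∉ γ '' Icc η (1 - η) := by
      rintro ⟨t, ht, hte⟩
      obtain ⟨n, rfl⟩ := hinj t hte
      have h1 : (0 : ℝ) < n := by linarith [ht.1]
      have h2 : (n : ℝ) < 1 := by linarith [ht.2]
      norm_cast at h1 h2
      omega
    filter_upwards [(hpath c).eventually (hcl.isOpen_compl.mem_nhds hn), self_mem_nhdsWithin]
      with h hh1 hh2
    rintro ⟨t, ht⟩
    -- The parameter is moved into `[-η, 1 - η)`, which the short and the long piece cover.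
    obtain ⟨s, hs, hst⟩ := hper.exists_mem_Ico one_pos t (-η)
    rw [hst] at ht
    rcases le_total s η with hsη | hsη
    · exact (hJval c h hh2 hc).1 ⟨s, ⟨hs.1, hsη⟩, ht⟩
    · exact hh1 ⟨s, ⟨hsη, by linarith [hs.2]⟩, ht⟩
  have hlogc : ∀ A : ℂ, A.im ≠ 0 →
      Tendsto (fun h : ℝ => Complex.log (A + h)) (𝓝[>] 0) (𝓝 (Complex.log A)) := by
    intro A hA
    have hc : ContinuousAt (fun h : ℝ => Complex.log (A + h)) 0 := by
      refine ContinuousAt.clog (by fun_prop) ?_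
      rw [Complex.mem_slitPlane_iff]
      right
      simpa using hA
    simpa using hc.tendsto.mono_left nhdsWithin_le_nhds
  have hJlim : ∀ c : ℂ, (c = Complex.I ∨ c = -Complex.I) →
      Tendsto (fun h : ℝ => J (γ 0 + h * (c * v))) (𝓝[>] 0)
        (𝓝 (Complex.log (c * ζ η) - Complex.log (c * ζ (-η)))) := by
    intro c hc
    refine Tendsto.congr' ?_ ((hlogc (c * ζ η) ?_).sub (hlogc (c * ζ (-η)) ?_))
    · filter_upwards [self_mem_nhdsWithin] with h hh
      exact (hJval c h hh hc).2.symm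
    · rcases hc with rfl | rfl <;> simpa using hA.ne'
    · rcases hc with rfl | rfl <;> simpa using hB.ne
  have hlim := ((hJlim _ (Or.inl rfl)).add (hKc.tendsto.comp (hpath Complex.I))).sub
    ((hJlim _ (Or.inr rfl)).add (hKc.tendsto.comp (hpath (-Complex.I))))
  -- Each end of the short piece contributes the half turn `π * I`.
  have hval : (Complex.log (Complex.I * ζ η) - Complex.log (Complex.I * ζ (-η)) + K (γ 0)) -
      (Complex.log (-Complex.I * ζ η) - Complex.log (-Complex.I * ζ (-η)) + K (γ 0)) =
      2 * Real.pi * Complex.I := by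
    have e1 := log_sub_log_neg_of_im_pos (A := Complex.I * ζ η) (by simpa using hA)
    have e2 := log_sub_log_neg_of_im_pos (A := -Complex.I * ζ (-η)) (by simpa using hB)
    simp only [neg_mul, neg_neg] at e1 e2 ⊢
    linear_combination e1 + e2
  rw [hval] at hlim
  have hfin := hlim.const_mul ((2 * Real.pi * Complex.I : ℂ)⁻¹)
  rw [inv_mul_cancel₀ Complex.two_pi_I_ne_zero] at hfin
  refine hfin.congr' ?_
  filter_upwards [hoff _ (Or.inl rfl), hoff _ (Or.inr rfl)] with h h1 h2
  rw [← neg_mul, hsplit _ h1, hsplit _ h2]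
  simp only [Function.comp]
  ring

/-! ### Coordinates spanned by two transverse curves -/

/-- The determinant of two vectors of the plane. -/
def planeDet (v w : ℂ) : ℝ := v.re * w.im - v.im * w.re

theorem planeDet_swap (v w : ℂ) : planeDet w v = -planeDet v w := by
  simp only [planeDet]; ring

/-- The coordinates of the plane with respect to two independent vectors. -/
noncomputable def planeCoords (v w : ℂ) (h : planeDet v w ≠ 0) : (ℝ × ℝ) ≃L[ℝ] ℂ :=
  LinearEquiv.toContinuousLinearEquiv
    { toFun := fun q => q.1 • v + q.2 • w
      map_add' := fun q q' => by simp only [Prod.fst_add, Prod.snd_add, add_smul]; ring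
      map_smul' := fun c q => by simp [mul_assoc]
      invFun := fun d => (planeDet d w / planeDet v w, planeDet v d / planeDet v w)
      left_inv := fun q => by
        ext
        · simp only [div_eq_iff h]
          simp only [planeDet, Complex.add_re, Complex.add_im, Complex.smul_re, Complex.smul_im,
            smul_eq_mul]
          ring
        · simp only [div_eq_iff h]
          simp only [planeDet, Complex.add_re, Complex.add_im, Complex.smul_re, Complex.smul_im,
            smul_eq_mul]
          ring
      right_inv := fun d => by
        apply Complex.ext <;>
        · simp only [Complex.add_re, Complex.add_im, Complex.smul_re, Complex.smul_im,
            smul_eq_mul]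
          rw [div_mul_eq_mul_div, div_mul_eq_mul_div, ← add_div, div_eq_iff h]
          simp only [planeDet]
          ring }

theorem hasStrictFDerivAt_add_curves {γ₁ γ₂ : ℝ → ℂ} (h₁ : ContDiff ℝ ∞ γ₁)
    (h₂ : ContDiff ℝ ∞ γ₂) (p : ℂ) (q : ℝ × ℝ)
    (hdet : planeDet (deriv γ₁ q.1) (deriv γ₂ q.2) ≠ 0) :
    HasStrictFDerivAt (fun q : ℝ × ℝ => γ₁ q.1 + γ₂ q.2 - p)
      (planeCoords _ _ hdet : ℝ × ℝ →L[ℝ] ℂ) q := by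
  have d₁ : HasStrictDerivAt γ₁ (deriv γ₁ q.1) q.1 :=
    (h₁.contDiffAt).hasStrictDerivAt (by simp)
  have d₂ : HasStrictDerivAt γ₂ (deriv γ₂ q.2) q.2 :=
    (h₂.contDiffAt).hasStrictDerivAt (by simp)
  have := ((d₁.hasStrictFDerivAt.comp q hasStrictFDerivAt_fst).add
    (d₂.hasStrictFDerivAt.comp q hasStrictFDerivAt_snd)).sub_const p
  convert! this using 1

/-- Inverse function theorem. If both curves pass through `p` at parameter `0`, these coordinates
straighten both at once: the axes are mapped to the curves. -/
theorem exists_openPartialHomeomorph_add_curves {γ₁ γ₂ : ℝ → ℂ} (h₁ : ContDiff ℝ ∞ γ₁)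
    (h₂ : ContDiff ℝ ∞ γ₂) (p : ℂ) (hdet : planeDet (deriv γ₁ 0) (deriv γ₂ 0) ≠ 0) :
    ∃ e : OpenPartialHomeomorph (ℝ × ℝ) ℂ, 0 ∈ e.source ∧ ∀ q, e q = γ₁ q.1 + γ₂ q.2 - p := by
  have h := hasStrictFDerivAt_add_curves h₁ h₂ p 0 hdet
  exact ⟨h.toOpenPartialHomeomorph _, h.mem_toOpenPartialHomeomorph_source, fun q => rfl⟩

theorem HasDerivAt.eventually_pos_mul_sub {f : ℝ → ℝ} {a : ℝ} (hf : HasDerivAt f a 0)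
    (ha : a ≠ 0) : ∀ᶠ h in 𝓝[>] (0 : ℝ), 0 < a * (f h - f 0) := by
  have h1 : Tendsto (fun h => a * slope f 0 h) (𝓝[>] 0) (𝓝 (a * a)) :=
    ((hasDerivAt_iff_tendsto_slope.1 hf).mono_left
      (nhdsWithin_mono _ fun x hx => ne_of_gt hx)).const_mul a
  filter_upwards [h1.eventually (lt_mem_nhds (mul_self_pos.2 ha)), self_mem_nhdsWithin] with h hh h0
  have h0' : (0 : ℝ) < h := h0
  rw [slope_def_field, sub_zero] at hh
  have := mul_pos hh h0'
  field_simp at this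
  linarith

/-- In the coordinates spanned by two curves, a point that moves along a line has velocity equal to
the coordinates of the direction of the line. -/
theorem hasDerivAt_symm_line {γ₁ γ₂ : ℝ → ℂ} (h₁ : ContDiff ℝ ∞ γ₁) (h₂ : ContDiff ℝ ∞ γ₂) {p : ℂ}
    {e : OpenPartialHomeomorph (ℝ × ℝ) ℂ} (he : ∀ q, e q = γ₁ q.1 + γ₂ q.2 - p)
    {q : ℝ × ℝ} (hq : q ∈ e.source) (hdet : planeDet (deriv γ₁ q.1) (deriv γ₂ q.2) ≠ 0) (d : ℂ) :
    HasDerivAt (fun h : ℝ => e.symm (e q + h * d))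
      (planeDet d (deriv γ₂ q.2) / planeDet (deriv γ₁ q.1) (deriv γ₂ q.2),
        planeDet (deriv γ₁ q.1) d / planeDet (deriv γ₁ q.1) (deriv γ₂ q.2)) 0 := by
  have hF := (hasStrictFDerivAt_add_curves h₁ h₂ p q hdet).hasFDerivAt
  have hsymm : e.symm (e q) = q := e.left_inv hq
  have hG : HasFDerivAt e.symm ((planeCoords _ _ hdet).symm : ℂ →L[ℝ] ℝ × ℝ) (e q) := by
    refine e.hasFDerivAt_symm (e.map_source hq) ?_
    rw [hsymm]
    convert! hF using 1
    exact funext he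
  have hline : HasDerivAt (fun h : ℝ => e q + h * d) d 0 := by
    have := ((Complex.ofRealCLM.hasDerivAt (x := (0 : ℝ))).mul_const d).const_add (e q)
    simpa using this
  have hG' : HasFDerivAt e.symm ((planeCoords _ _ hdet).symm : ℂ →L[ℝ] ℝ × ℝ)
      (e q + ((0 : ℝ) : ℂ) * d) := by simpa using hG
  have := hG'.comp_hasDerivAt (0 : ℝ) hline
  convert! this using 1

/-- The velocity in coordinates is given by Cramer's rule, and a nonzero velocity component fixes
the sign of the coordinate's increment for small `h > 0`. Writing signs as positive products avoids
case distinctions on orientation. -/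
theorem eventually_symm_line {γ₁ γ₂ : ℝ → ℂ} (h₁ : ContDiff ℝ ∞ γ₁) (h₂ : ContDiff ℝ ∞ γ₂) {p : ℂ}
    {e : OpenPartialHomeomorph (ℝ × ℝ) ℂ} (he : ∀ q, e q = γ₁ q.1 + γ₂ q.2 - p)
    {q : ℝ × ℝ} (hq : q ∈ e.source) (hdet : planeDet (deriv γ₁ q.1) (deriv γ₂ q.2) ≠ 0) (d : ℂ)
    {U : Set (ℝ × ℝ)} (hU : U ∈ 𝓝 q) :
    ∀ᶠ h : ℝ in 𝓝[>] 0, ∃ q' ∈ U, e q' = e q + h * d ∧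
      (planeDet d (deriv γ₂ q.2) ≠ 0 → 0 < planeDet d (deriv γ₂ q.2) *
        planeDet (deriv γ₁ q.1) (deriv γ₂ q.2) * (q'.1 - q.1)) ∧
      (planeDet (deriv γ₁ q.1) d ≠ 0 → 0 < planeDet (deriv γ₁ q.1) d *
        planeDet (deriv γ₁ q.1) (deriv γ₂ q.2) * (q'.2 - q.2)) := by
  have hd := hasDerivAt_symm_line h₁ h₂ he hq hdet d
  set G : ℝ → ℝ × ℝ := fun h : ℝ => e.symm (e q + h * d) with hG
  have hd1 := (ContinuousLinearMap.fst ℝ ℝ ℝ).hasFDerivAt.comp_hasDerivAt (0 : ℝ) hd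
  have hd2 := (ContinuousLinearMap.snd ℝ ℝ ℝ).hasFDerivAt.comp_hasDerivAt (0 : ℝ) hd
  have hG0 : G 0 = q := by simp [hG, e.left_inv hq]
  have hpath : ContinuousAt (fun h : ℝ => e q + h * d) 0 := by fun_prop
  have ht : ∀ᶠ h : ℝ in 𝓝 0, e q + h * d ∈ e.target :=
    hpath.eventually_mem (by simpa using e.open_target.mem_nhds (e.map_source hq))
  have hUn : ∀ᶠ h in 𝓝 (0 : ℝ), G h ∈ U := hd.continuousAt.eventually_mem (by rwa [hG0])
  have hsgn : ∀ {a x : ℝ}, 0 < a / planeDet (deriv γ₁ q.1) (deriv γ₂ q.2) * x →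
      0 < a * planeDet (deriv γ₁ q.1) (deriv γ₂ q.2) * x := by
    intro a x h
    have := mul_pos h (mul_self_pos.2 hdet)
    field_simp at this
    linarith
  have hfst : ∀ᶠ h : ℝ in 𝓝[>] 0, planeDet d (deriv γ₂ q.2) ≠ 0 →
      0 < planeDet d (deriv γ₂ q.2) * planeDet (deriv γ₁ q.1) (deriv γ₂ q.2) *
        ((G h).1 - q.1) := by
    by_cases h0 : planeDet d (deriv γ₂ q.2) = 0
    · simp [h0]
    · filter_upwards [HasDerivAt.eventually_pos_mul_sub (f := fun h => (G h).1) hd1 (div_ne_zero h0 hdet)] with h hh _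
      exact hsgn (by simpa only [hG0, ContinuousLinearMap.coe_fst'] using hh)
  have hsnd : ∀ᶠ h : ℝ in 𝓝[>] 0, planeDet (deriv γ₁ q.1) d ≠ 0 →
      0 < planeDet (deriv γ₁ q.1) d * planeDet (deriv γ₁ q.1) (deriv γ₂ q.2) *
        ((G h).2 - q.2) := by
    by_cases h0 : planeDet (deriv γ₁ q.1) d = 0
    · simp [h0]
    · filter_upwards [HasDerivAt.eventually_pos_mul_sub (f := fun h => (G h).2) hd2 (div_ne_zero h0 hdet)] with h hh _
      exact hsgn (by simpa only [hG0, ContinuousLinearMap.coe_snd'] using hh)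
  filter_upwards [nhdsWithin_le_nhds ht, nhdsWithin_le_nhds hUn, hfst, hsnd] with h i1 i2 i3 i4
  exact ⟨G h, i2, e.right_inv i1, i3, i4⟩

namespace LinkDiagram

variable {l : ℕ} {X : Type*} [TopologicalSpace X]

/-! ### Parametrizations of the link -/

/-- The point of the link at parameter distance `t` from `α`. -/
def shift (α : Fin l × UnitAddCircle) (t : ℝ) : Fin l × UnitAddCircle :=
  (α.1, α.2 + (t : UnitAddCircle))

@[simp] theorem shift_zero (α : Fin l × UnitAddCircle) : shift α 0 = α := by
  simp [shift]

theorem shift_shift (α : Fin l × UnitAddCircle) (s t : ℝ) :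
    shift (shift α s) t = shift α (s + t) := by
  simp [shift, add_assoc]

theorem map_shift_nhds (α : Fin l × UnitAddCircle) : map (shift α) (𝓝 0) = 𝓝 α := by
  obtain ⟨i, θ⟩ := α
  have h1 : map (fun t : ℝ => (t : UnitAddCircle)) (𝓝 0) = 𝓝 0 :=
    (QuotientAddGroup.nhds_eq _ 0).symm
  have h2 : map (fun t : ℝ => θ + (t : UnitAddCircle)) (𝓝 0) = 𝓝 θ := by
    have h3 := map_add_left_nhds_zero θ
    rw [← h1, map_map] at h3
    exact h3
  rw [nhds_prod_eq, nhds_discrete (Fin l), pure_prod, ← h2, map_map]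
  rfl

theorem contDiff_curve_shift (D : LinkDiagram l) (α : Fin l × UnitAddCircle) :
    ContDiff ℝ ∞ fun t => D.point (shift α t) := by
  obtain ⟨i, θ⟩ := α
  obtain ⟨t₀, rfl⟩ := QuotientAddGroup.mk_surjective θ
  have : (fun t => D.point (shift (i, (t₀ : UnitAddCircle)) t)) =
      (fun t : ℝ => D.curve i (t : UnitAddCircle)) ∘ fun t => t₀ + t := by
    funext t
    simp [point, shift]
  refine this ▸ (D.smooth i).comp (by fun_prop)

theorem periodic_curve_shift (D : LinkDiagram l) (α : Fin l × UnitAddCircle) :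
    Function.Periodic (fun t => D.point (shift α t)) 1 := fun t => by
  simp [point, shift]

theorem deriv_curve_shift (D : LinkDiagram l) (α : Fin l × UnitAddCircle) (s : ℝ) :
    deriv (fun t => D.point (shift α t)) s = D.velocity (shift α s) := by
  have : (fun t : ℝ => D.curve (shift α s).1 ((shift α s).2 + (t : UnitAddCircle))) =
      fun t => (fun t => D.point (shift α t)) (s + t) := by
    funext t
    simp [point, shift, add_assoc]
  rw [velocity, this, deriv_comp_const_add (f := fun t => D.point (shift α t)) s 0, add_zero]

theorem velocity_ne_zero (D : LinkDiagram l) (α : Fin l × UnitAddCircle) : D.velocity α ≠ 0 :=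
  D.immersed α.1 α.2

theorem continuous_curve (D : LinkDiagram l) (i : Fin l) : Continuous (D.curve i) :=
  continuous_coinduced_dom.2 (D.smooth i).continuous

theorem continuous_point (D : LinkDiagram l) : Continuous D.point :=
  continuous_prod_of_discrete_left.2 D.continuous_curve

theorem isCompact_image (D : LinkDiagram l) : IsCompact D.image :=
  isCompact_range D.continuous_point

theorem planeDet_velocity_ne_zero (D : LinkDiagram l) {α β : Fin l × UnitAddCircle} (h : α ≠ β)
    (hp : D.point α = D.point β) : planeDet (D.velocity α) (D.velocity β) ≠ 0 := by
  intro h0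
  have hli := D.transverse α β h hp
  change LinearIndependent ℝ ![D.velocity α, D.velocity β] at hli
  rw [LinearIndependent.pair_iff] at hli
  set v := D.velocity α
  set w := D.velocity β
  -- If the determinant vanishes, so do `w.re • v - v.re • w` and `w.im • v - v.im • w`;
  -- independence then forces `w = 0`.
  have h1 := hli w.re (-v.re) (by
    apply Complex.ext
    · simp; ring
    · simp only [planeDet] at h0; simp; linarith)
  have h2 := hli w.im (-v.im) (by
    apply Complex.ext
    · simp only [planeDet] at h0; simp; linarith
    · simp; ring)
  exact D.velocity_ne_zero β (Complex.ext h1.1 h2.1)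

/-- A point of the link that does not lie over a double point. -/
def IsRegular (D : LinkDiagram l) (α : Fin l × UnitAddCircle) : Prop :=
  ∀ β, D.point β = D.point α → β = α

/-! ### Local coordinates of a diagram -/

/-- Coordinates near a point `α` of a diagram, in which the first axis is the strand through `α`
and the second axis is a curve `γ` through its image, which may be the strand through `β`
(if `Q` holds). -/
structure Chart (D : LinkDiagram l) (α β : Fin l × UnitAddCircle) (γ : ℝ → ℂ) (Q : Prop) where
  e : OpenPartialHomeomorph (ℝ × ℝ) ℂ
  r : ℝ
  r_pos : 0 < r
  ball_subset : Metric.ball 0 r ⊆ e.source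
  apply : ∀ q, e q = D.point (shift α q.1) + γ q.2 - D.point α
  fibre : ∀ q ∈ Metric.ball (0 : ℝ × ℝ) r, ∀ δ, D.point δ = e q →
    q.2 = 0 ∧ δ = shift α q.1 ∨ Q ∧ q.1 = 0 ∧ δ = shift β q.2
  det_pos : ∀ s : ℝ, |s| < r → 0 < planeDet (D.velocity (shift α s)) (deriv γ 0) *
    planeDet (D.velocity α) (deriv γ 0)

/-- By compactness of the link, points with image near that of `α` are near the fibre, which is
contained in `{α, β}`; injectivity of the coordinates then places them on an axis. `Q` is false at
regular points, where `γ` is an auxiliary transversal, and true at double points, where `γ` is the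
second strand. -/
theorem nonempty_chart (D : LinkDiagram l) (α β : Fin l × UnitAddCircle) {γ : ℝ → ℂ} (Q : Prop)
    (hγ : ContDiff ℝ ∞ γ) (h0 : γ 0 = D.point α)
    (hdet : planeDet (D.velocity α) (deriv γ 0) ≠ 0)
    (hQ : Q → ∀ t, D.point (shift β t) = γ t)
    (hfib : ∀ δ, D.point δ = D.point α → δ = α ∨ Q ∧ δ = β) :
    Nonempty (D.Chart α β γ Q) := by
  have hα := D.contDiff_curve_shift α
  have hdα := D.deriv_curve_shift α
  obtain ⟨e, he0, he⟩ := exists_openPartialHomeomorph_add_curves hα hγ (D.point α)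
    (by rwa [hdα, shift_zero])
  have hez : e 0 = D.point α := by simp [he, h0]
  obtain ⟨r₁, hr₁, hsub⟩ := Metric.isOpen_iff.1 e.open_source 0 he0
  -- points of the link with nearby images are near the fibre
  set V : Set (Fin l × UnitAddCircle) :=
    {δ | (∃ s, |s| < r₁ ∧ δ = shift α s) ∨ Q ∧ ∃ t, |t| < r₁ ∧ δ = shift β t} with hV
  have hshift : ∀ δ : Fin l × UnitAddCircle, {δ' | ∃ s, |s| < r₁ ∧ δ' = shift δ s} ∈ 𝓝 δ := by
    intro δ
    rw [← map_shift_nhds]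
    refine mem_map.2 ?_
    filter_upwards [Metric.ball_mem_nhds (0 : ℝ) hr₁] with s hs
    exact ⟨s, by simpa using hs, rfl⟩
  have hVn : V ∈ 𝓝ˢ (D.point ⁻¹' {D.point α}) := by
    rw [mem_nhdsSet_iff_forall]
    intro δ hδ
    rcases hfib δ hδ with rfl | ⟨q, rfl⟩
    · exact mem_of_superset (hshift δ) fun _ h => Or.inl h
    · exact mem_of_superset (hshift δ) fun _ h => Or.inr ⟨q, h⟩
  -- For a closed map, preimages of small neighbourhoods of a point lie in any given neighbourhood
  -- of its fibre.
  have hN := D.continuous_point.isClosedMap.comap_nhds_le hVn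
  obtain ⟨N, hN, hNV⟩ := mem_comap.1 hN
  have h1 : ∀ᶠ q in 𝓝 (0 : ℝ × ℝ), e q ∈ N :=
    (e.continuousAt he0).eventually_mem (by rwa [hez])
  have h2 : ∀ᶠ s in 𝓝 (0 : ℝ), 0 < planeDet (D.velocity (shift α s)) (deriv γ 0) *
      planeDet (D.velocity α) (deriv γ 0) := by
    have hc : Continuous fun s => planeDet (D.velocity (shift α s)) (deriv γ 0) *
        planeDet (D.velocity α) (deriv γ 0) := by
      have : Continuous fun s => D.velocity (shift α s) := by
        simp only [← hdα]
        exact hα.continuous_deriv (by simp)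
      simp only [planeDet]
      fun_prop
    refine hc.continuousAt.eventually (lt_mem_nhds ?_)
    simpa only [shift_zero] using mul_self_pos.2 hdet
  obtain ⟨r₂, hr₂, hb₂⟩ := Metric.eventually_nhds_iff_ball.1 h1
  obtain ⟨r₃, hr₃, hb₃⟩ := Metric.eventually_nhds_iff_ball.1 h2
  refine ⟨⟨e, min r₁ (min r₂ r₃), by positivity,
    (Metric.ball_subset_ball (min_le_left _ _)).trans hsub, he, ?_, ?_⟩⟩
  · intro q hq δ hδ
    have hq1 := Metric.ball_subset_ball (min_le_left r₁ (min r₂ r₃)) hq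
    have hq2 := Metric.ball_subset_ball ((min_le_right r₁ (min r₂ r₃)).trans (min_le_left _ _)) hq
    have hδN : D.point δ ∈ N := hδ ▸ hb₂ q hq2
    rcases hNV hδN with ⟨s, hs, rfl⟩ | ⟨hq, t, ht, rfl⟩
    · have hs' : ((s, 0) : ℝ × ℝ) ∈ Metric.ball (0 : ℝ × ℝ) r₁ := by
        simp [Prod.norm_def, hs]
      have : e (s, 0) = e q := by rw [← hδ, he]; simp [h0]
      have := e.injOn (hsub hs') (hsub hq1) this
      left
      rw [← this]
      exact ⟨rfl, rfl⟩
    · have ht' : ((0, t) : ℝ × ℝ) ∈ Metric.ball (0 : ℝ × ℝ) r₁ := by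
        simp [Prod.norm_def, ht]
      have : e (0, t) = e q := by rw [← hδ, he]; simp [hQ hq]
      have := e.injOn (hsub ht') (hsub hq1) this
      right
      rw [← this]
      exact ⟨hq, rfl, rfl⟩
  · intro s hs
    exact hb₃ s (by simpa using hs.trans_le ((min_le_right r₁ (min r₂ r₃)).trans (min_le_right _ _)))

/-! ### Regions and connected sets off the diagram -/

variable {D : LinkDiagram l} {ι : ℂ → X}

theorem Region.subset_compl (R : D.Region ι) : R.1 ⊆ (ι '' D.image)ᶜ := by
  obtain ⟨_, p, _, rfl⟩ := R
  exact connectedComponentIn_subset _ _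

/-- The region that contains a given point of the plane. -/
def regionOf (D : LinkDiagram l) (ι : ℂ → X) (hinj : Function.Injective ι) (z : ℂ)
    (hz : z ∉ D.image) : D.Region ι :=
  ⟨connectedComponentIn (ι '' D.image)ᶜ (ι z), ι z, by rwa [mem_compl_iff, hinj.mem_set_image],
    rfl⟩

theorem mem_regionOf (hinj : Function.Injective ι) {z : ℂ} (hz : z ∉ D.image) :
    ι z ∈ (D.regionOf ι hinj z hz).1 :=
  mem_connectedComponentIn (by rwa [mem_compl_iff, hinj.mem_set_image])

theorem Region.eq_of_mem {R S : D.Region ι} {x : X} (hR : x ∈ R.1) (hS : x ∈ S.1) : R = S := by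
  obtain ⟨R, p, _, rfl⟩ := R
  obtain ⟨S, q, _, rfl⟩ := S
  exact Subtype.ext ((connectedComponentIn_eq hR).trans (connectedComponentIn_eq hS).symm)

theorem Region.notMem_image {R : D.Region ι} {z : ℂ} (h : ι z ∈ R.1) : z ∉ D.image :=
  fun hz => R.subset_compl h ⟨z, hz, rfl⟩

/-- A connected subset of the complement of the diagram is contained in a region. -/
theorem exists_region_of_isPreconnected (hι : Continuous ι) (hinj : Function.Injective ι)
    {S : Set ℂ} (hS : IsPreconnected S) (hne : S.Nonempty) (hd : ∀ z ∈ S, z ∉ D.image) :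
    ∃ R : D.Region ι, ∀ z ∈ S, ι z ∈ R.1 := by
  obtain ⟨z₀, hz₀⟩ := hne
  refine ⟨D.regionOf ι hinj z₀ (hd z₀ hz₀), fun z hz => ?_⟩
  have h1 : IsPreconnected (ι '' S) := hS.image ι hι.continuousOn
  refine h1.subset_connectedComponentIn (mem_image_of_mem _ hz₀) ?_ (mem_image_of_mem _ hz)
  rintro _ ⟨y, hy, rfl⟩
  rw [mem_compl_iff, hinj.mem_set_image]
  exact hd y hy

namespace Chart

variable {α β : Fin l × UnitAddCircle} {γ : ℝ → ℂ} {Q : Prop}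

/-- By `fibre` the diagram meets the chart at most in the first axis and, if `Q` holds, the second
one; a convex set avoiding them has a connected image off the diagram. -/
theorem exists_region (C : D.Chart α β γ Q) (hι : Continuous ι) (hinj : Function.Injective ι)
    {S : Set (ℝ × ℝ)} (hS : Convex ℝ S) (hne : S.Nonempty) (hsub : S ⊆ Metric.ball 0 C.r)
    (h2 : ∀ q ∈ S, q.2 ≠ 0) (h1 : Q → ∀ q ∈ S, q.1 ≠ 0) :
    ∃ R : D.Region ι, ∀ q ∈ S, ι (C.e q) ∈ R.1 := by
  obtain ⟨R, hR⟩ := exists_region_of_isPreconnected (D := D) hι hinj (S := C.e '' S)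
    (hS.isPreconnected.image _ (C.e.continuousOn.mono (hsub.trans C.ball_subset)))
    (hne.image _) (by
      rintro _ ⟨q, hq, rfl⟩ ⟨δ, hδ⟩
      rcases C.fibre q (hsub hq) δ hδ with h | h
      · exact h2 q hq h.1
      · exact h1 h.1 q hq h.2.1)
  exact ⟨R, fun q hq => hR _ (mem_image_of_mem _ hq)⟩

theorem zero_mem_ball (C : D.Chart α β γ Q) : (0 : ℝ × ℝ) ∈ Metric.ball 0 C.r :=
  Metric.mem_ball_self C.r_pos

theorem axis_mem_ball (C : D.Chart α β γ Q) {s : ℝ} (hs : |s| < C.r) :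
    ((s, 0) : ℝ × ℝ) ∈ Metric.ball (0 : ℝ × ℝ) C.r := by
  simp [Prod.norm_def, hs]

theorem apply_axis (C : D.Chart α β γ Q) (h0 : γ 0 = D.point α) (s : ℝ) :
    C.e (s, 0) = D.point (shift α s) := by
  rw [C.apply]
  simp [h0]

theorem isRegular (C : D.Chart α β γ Q) (h0 : γ 0 = D.point α) {s : ℝ} (hs : |s| < C.r)
    (hQ : Q → s ≠ 0) : D.IsRegular (shift α s) := by
  intro δ hδ
  rw [← C.apply_axis h0] at hδ
  rcases C.fibre _ (C.axis_mem_ball hs) δ hδ with h | h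
  · exact h.2
  · exact absurd h.2.1 (hQ h.1)

/-- Points next to the diagram in a given direction, in the coordinates of the chart. -/
theorem touches (C : D.Chart α β γ Q) (hγ : ContDiff ℝ ∞ γ) (h0 : γ 0 = D.point α)
    {s : ℝ} (hs : |s| < C.r) (d : ℂ) {R : D.Region ι} {U S : Set (ℝ × ℝ)} (hU : U ∈ 𝓝 (s, 0))
    (hS : ∀ q ∈ S, ι (C.e q) ∈ R.1)
    (h : ∀ q ∈ U, q ∈ Metric.ball 0 C.r →
      (planeDet d (deriv γ 0) ≠ 0 → 0 < planeDet d (deriv γ 0) *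
        planeDet (D.velocity α) (deriv γ 0) * (q.1 - s)) →
      (planeDet (D.velocity (shift α s)) d ≠ 0 → 0 < planeDet (D.velocity (shift α s)) d *
        planeDet (D.velocity α) (deriv γ 0) * q.2) → q ∈ S) :
    D.Touches ι (D.point (shift α s)) d R := by
  have hdα := D.deriv_curve_shift α
  have hdet := C.det_pos s hs
  have hm := C.axis_mem_ball hs
  have := eventually_symm_line (D.contDiff_curve_shift α) hγ C.apply (C.ball_subset hm)
    (by rw [hdα]; exact left_ne_zero_of_mul hdet.ne') d
    (inter_mem hU (Metric.isOpen_ball.mem_nhds hm))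
  rw [C.apply_axis h0] at this
  refine this.mono fun h' => ?_
  rintro ⟨q, ⟨hqU, hqb⟩, he, hx, hy⟩
  rw [← he]
  simp only [hdα, sub_zero] at hx hy
  -- By `det_pos` the determinants at `s` and at `0` have equal signs, so one may replace the other
  -- in a sign condition.
  have flip : ∀ {a b x y : ℝ}, 0 < x * y → 0 < a * x * b → 0 < a * y * b := by
    intro a b x y hxy hab
    have h1 := mul_pos hxy hab
    have hx0 : 0 < x ^ 2 := by
      have : x ≠ 0 := left_ne_zero_of_mul hxy.ne'
      positivity
    have h2 : 0 < x ^ 2 * (a * y * b) := by linarith [h1, show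
      x * y * (a * x * b) = x ^ 2 * (a * y * b) by ring]
    exact pos_of_mul_pos_right h2 hx0.le
  exact hS q (h q hqU hqb (fun hne => flip hdet (hx hne)) fun hne => flip hdet (hy hne))

theorem eventually_mem_image (C : D.Chart α β γ Q) (h0 : γ 0 = D.point α) :
    ∀ᶠ z in 𝓝 (D.point α), ∃ q ∈ Metric.ball 0 C.r, C.e q = z := by
  have hs := C.ball_subset C.zero_mem_ball
  have h1 : C.e 0 = D.point α := (C.apply_axis h0 0).trans (by rw [shift_zero])
  rw [← h1]
  rw [← C.e.map_nhds_eq hs]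
  refine eventually_map.2 ?_
  filter_upwards [Metric.isOpen_ball.mem_nhds C.zero_mem_ball] with q hq
  exact ⟨q, hq, rfl⟩

end Chart

end LinkDiagram

namespace LinkDiagram

variable {l : ℕ} {X : Type*} [TopologicalSpace X] {D : LinkDiagram l} {ι : ℂ → X}

/-! ### Regions near a point of a diagram -/

theorem planeDet_I_mul_self (v : ℂ) : planeDet v (Complex.I * v) = Complex.normSq v := by
  simp [planeDet, Complex.normSq_apply]

/-- Near a regular point, a diagram has a left side and a right side. -/
theorem exists_sides (hι : Continuous ι) (hinj : Function.Injective ι) {α : Fin l × UnitAddCircle}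
    (hα : D.IsRegular α) :
    ∃ L R : D.Region ι,
      (∀ᶠ s : ℝ in 𝓝 0, D.IsRegular (shift α s) ∧
        D.Touches ι (D.point (shift α s)) (Complex.I * D.velocity (shift α s)) L ∧
        D.Touches ι (D.point (shift α s)) (-(Complex.I * D.velocity (shift α s))) R) ∧
      ∀ᶠ z in 𝓝 (D.point α), z ∉ D.image → ι z ∈ L.1 ∨ ι z ∈ R.1 := by
  set v := D.velocity α with hv
  -- The transversal is the normal line. Its determinant with the velocity is `normSq v > 0`, so a
  -- positive second coordinate means the left side.
  set γ : ℝ → ℂ := fun t => D.point α + t * (Complex.I * v) with hγ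
  have hγs : ContDiff ℝ ∞ γ := contDiff_const.add (Complex.ofRealCLM.contDiff.mul contDiff_const)
  have hγd : deriv γ 0 = Complex.I * v := by
    have : HasDerivAt γ _ 0 := ((Complex.ofRealCLM.hasDerivAt (x := (0 : ℝ))).mul_const
      (Complex.I * v)).const_add (D.point α)
    exact this.deriv.trans (by simp)
  have h0 : γ 0 = D.point α := by simp [hγ]
  have hdet : 0 < planeDet (D.velocity α) (deriv γ 0) := by
    rw [hγd, planeDet_I_mul_self]
    exact Complex.normSq_pos.2 (D.velocity_ne_zero α)
  obtain ⟨C⟩ := D.nonempty_chart α α False hγs h0 hdet.ne' (fun h => h.elim)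
    (fun δ h => Or.inl (hα δ h))
  have hr := C.r_pos
  have hside : ∀ τ : ℝ, |τ| = 1 → ∃ R : D.Region ι,
      ∀ q ∈ {q : ℝ × ℝ | q ∈ Metric.ball 0 C.r ∧ 0 < τ * q.2}, ι (C.e q) ∈ R.1 := by
    intro τ hτ
    have hττ : τ * τ = 1 := by rw [← abs_mul_abs_self, hτ, one_mul]
    refine C.exists_region hι hinj ?_ ?_ (fun q hq => hq.1) (fun q hq h => ?_) (fun h => h.elim)
    · refine (convex_ball _ _).inter ?_
      exact (convex_Ioi (0 : ℝ)).linear_preimage (τ • LinearMap.snd ℝ ℝ ℝ)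
    · refine ⟨(0, τ * (C.r / 2)), ?_, ?_⟩
      · simp [Prod.norm_def, hτ, abs_of_pos hr, hr]
      · change 0 < τ * (τ * (C.r / 2))
        rw [← mul_assoc, hττ]
        linarith
    · have h2 := hq.2
      rw [h, mul_zero] at h2
      exact lt_irrefl _ h2
  obtain ⟨L, hL⟩ := hside 1 (by simp)
  obtain ⟨R, hR⟩ := hside (-1) (by simp)
  refine ⟨L, R, ?_, ?_⟩
  · filter_upwards [Metric.ball_mem_nhds (0 : ℝ) hr] with s hs
    have hs' : |s| < C.r := by simpa using hs
    have hvs := D.velocity_ne_zero (shift α s)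
    have hns := Complex.normSq_pos.2 hvs
    refine ⟨C.isRegular h0 hs' (fun h => h.elim), ?_, ?_⟩
    · refine C.touches hγs h0 hs' _ univ_mem hL fun q _ hq _ hy => ⟨hq, ?_⟩
      rw [planeDet_I_mul_self] at hy
      rw [one_mul]
      exact pos_of_mul_pos_right (hy hns.ne') (mul_pos hns hdet).le
    · refine C.touches hγs h0 hs' _ univ_mem hR fun q _ hq _ hy => ⟨hq, ?_⟩
      have e1 : planeDet (D.velocity (shift α s)) (-(Complex.I * D.velocity (shift α s))) =
          -Complex.normSq (D.velocity (shift α s)) := by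
        rw [← planeDet_I_mul_self]; simp [planeDet]; ring
      rw [e1] at hy
      refine pos_of_mul_pos_right (b := -1 * q.2) ?_ (mul_pos hns hdet).le
      linarith [hy (neg_ne_zero.2 hns.ne')]
  · filter_upwards [C.eventually_mem_image h0] with z ⟨q, hq, hz⟩ hzi
    rcases lt_trichotomy q.2 0 with h | h | h
    · right; rw [← hz]; exact hR q ⟨hq, by linarith⟩
    · refine absurd ⟨shift α q.1, ?_⟩ hzi
      rw [← hz, C.apply, h, h0]
      ring
    · left; rw [← hz]; exact hL q ⟨hq, by linarith⟩

theorem units_int_mul_pos_cases (x : ℝ) (hx : x ≠ 0) : ∃ σ : ℤˣ, 0 < ((σ : ℤ) : ℝ) * x := by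
  rcases lt_or_gt_of_ne hx with h | h
  · exact ⟨-1, by simpa using h⟩
  · exact ⟨1, by simpa using h⟩

/-- Near a double point, a diagram has four corners. -/
theorem exists_corners (hι : Continuous ι) (hinj : Function.Injective ι)
    {α β : Fin l × UnitAddCircle} (hne : α ≠ β) (hp : D.point α = D.point β) {ε : ℤˣ}
    (hε : 0 < ((ε : ℤ) : ℝ) * planeDet (D.velocity α) (D.velocity β)) :
    ∃ R : ℤˣ → ℤˣ → D.Region ι,
      (∀ σ τ : ℤˣ, D.Touches ι (D.point α)
        (((σ : ℤ) : ℂ) * D.velocity α + ((τ : ℤ) : ℂ) * D.velocity β) (R σ τ)) ∧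
      (∀ σ : ℤˣ, ∀ᶠ s : ℝ in 𝓝[>] 0, D.IsRegular (shift α ((σ : ℤ) * s)) ∧
        D.Touches ι (D.point (shift α ((σ : ℤ) * s)))
          (Complex.I * D.velocity (shift α ((σ : ℤ) * s))) (R σ ε) ∧
        D.Touches ι (D.point (shift α ((σ : ℤ) * s)))
          (-(Complex.I * D.velocity (shift α ((σ : ℤ) * s)))) (R σ (-ε))) ∧
      ∀ᶠ z in 𝓝 (D.point α), z ∉ D.image → ∃ σ τ, ι z ∈ (R σ τ).1 := by
  have hγs := D.contDiff_curve_shift β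
  set γ : ℝ → ℂ := fun t => D.point (shift β t) with hγ
  have hγd : deriv γ 0 = D.velocity β := by
    rw [hγ, deriv_curve_shift, shift_zero]
  have h0 : γ 0 = D.point α := by simp [hγ, hp]
  have hdet : planeDet (D.velocity α) (deriv γ 0) ≠ 0 := by
    rw [hγd]
    exact D.planeDet_velocity_ne_zero hne hp
  obtain ⟨C⟩ := D.nonempty_chart α β True hγs h0 hdet (fun _ _ => rfl) (fun δ h => by
    rcases D.double δ α β h hp with h | h | h
    · exact Or.inl h
    · exact absurd h hne
    · exact Or.inr ⟨trivial, h⟩)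
  have hr := C.r_pos
  have hu : ∀ σ : ℤˣ, |((σ : ℤ) : ℝ)| = 1 ∧ ((σ : ℤ) : ℝ) * ((σ : ℤ) : ℝ) = 1 := by
    intro σ
    rcases Int.units_eq_one_or σ with rfl | rfl <;> simp
  -- The corners are the open quadrants of the chart. Since `ε` is the sign of the determinant of
  -- the velocities, the quadrants with `τ = ε` lie to the left of the strand through `α`.
  have hquad : ∀ σ τ : ℤˣ, ∃ R : D.Region ι,
      ∀ q ∈ {q : ℝ × ℝ | q ∈ Metric.ball 0 C.r ∧ 0 < ((σ : ℤ) : ℝ) * q.1 ∧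
        0 < ((τ : ℤ) : ℝ) * q.2}, ι (C.e q) ∈ R.1 := by
    intro σ τ
    refine C.exists_region hι hinj ?_ ?_ (fun q hq => hq.1) (fun q hq h => ?_)
      (fun _ q hq h => ?_)
    · refine (convex_ball _ _).inter (Convex.inter ?_ ?_)
      · exact (convex_Ioi (0 : ℝ)).linear_preimage (((σ : ℤ) : ℝ) • LinearMap.fst ℝ ℝ ℝ)
      · exact (convex_Ioi (0 : ℝ)).linear_preimage (((τ : ℤ) : ℝ) • LinearMap.snd ℝ ℝ ℝ)
    · refine ⟨((σ : ℤ) * (C.r / 2), (τ : ℤ) * (C.r / 2)), ?_, ?_, ?_⟩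
      · simp [Prod.norm_def, (hu σ).1, (hu τ).1, abs_of_pos hr, hr]
      · change 0 < ((σ : ℤ) : ℝ) * (((σ : ℤ) : ℝ) * (C.r / 2))
        rw [← mul_assoc, (hu σ).2]
        linarith
      · change 0 < ((τ : ℤ) : ℝ) * (((τ : ℤ) : ℝ) * (C.r / 2))
        rw [← mul_assoc, (hu τ).2]
        linarith
    · have h2 := hq.2.2
      rw [h, mul_zero] at h2
      exact lt_irrefl _ h2
    · have h2 := hq.2.1
      rw [h, mul_zero] at h2
      exact lt_irrefl _ h2
  choose R hR using hquad
  refine ⟨R, fun σ τ => ?_, fun σ => ?_, ?_⟩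
  · have := C.touches hγs h0 (s := 0) (by simpa using hr)
      (((σ : ℤ) : ℂ) * D.velocity α + ((τ : ℤ) : ℂ) * D.velocity β) univ_mem (hR σ τ)
      fun q _ hq hx hy => ⟨hq, ?_⟩
    · rwa [shift_zero] at this
    rw [hγd] at hx hy hdet
    rw [shift_zero] at hy
    have e1 : planeDet (((σ : ℤ) : ℂ) * D.velocity α + ((τ : ℤ) : ℂ) * D.velocity β)
        (D.velocity β) = (σ : ℤ) * planeDet (D.velocity α) (D.velocity β) := by
      simp [planeDet]; ring
    have e2 : planeDet (D.velocity α)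
        (((σ : ℤ) : ℂ) * D.velocity α + ((τ : ℤ) : ℂ) * D.velocity β) =
        (τ : ℤ) * planeDet (D.velocity α) (D.velocity β) := by
      simp [planeDet]; ring
    have hσ0 : ∀ σ : ℤˣ, ((σ : ℤ) : ℝ) ≠ 0 := fun σ h => by
      have := (hu σ).2
      rw [h] at this
      simp at this
    rw [e1] at hx
    rw [e2] at hy
    have hx := hx (mul_ne_zero (hσ0 σ) hdet)
    have hy := hy (mul_ne_zero (hσ0 τ) hdet)
    have hsq := mul_self_nonneg (planeDet (D.velocity α) (D.velocity β))
    constructor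
    · exact pos_of_mul_pos_right (by linarith) hsq
    · exact pos_of_mul_pos_right (by linarith) hsq
  · filter_upwards [nhdsWithin_le_nhds (Metric.ball_mem_nhds (0 : ℝ) hr), self_mem_nhdsWithin]
      with s hs hs0
    have hs0 : 0 < s := hs0
    have hs' : |((σ : ℤ) : ℝ) * s| < C.r := by
      rw [abs_mul, (hu σ).1, one_mul]
      simpa using hs
    have hσs : 0 < ((σ : ℤ) : ℝ) * (((σ : ℤ) : ℝ) * s) := by
      rw [← mul_assoc, (hu σ).2, one_mul]; exact hs0
    set s' := ((σ : ℤ) : ℝ) * s with hs'd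
    have hns := Complex.normSq_pos.2 (D.velocity_ne_zero (shift α s'))
    -- The normal direction need not control the first coordinate; its sign is kept by staying near
    -- `(s', 0)`.
    have hU : {q : ℝ × ℝ | 0 < ((σ : ℤ) : ℝ) * q.1} ∈ 𝓝 ((s', 0) : ℝ × ℝ) := by
      refine IsOpen.mem_nhds (isOpen_lt continuous_const (by fun_prop)) ?_
      exact hσs
    rw [← hγd] at hε
    have hkey : ∀ x : ℝ, 0 < Complex.normSq (D.velocity (shift α s')) *
        planeDet (D.velocity α) (deriv γ 0) * x → 0 < ((ε : ℤ) : ℝ) * x := by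
      intro x hx
      have h1 := mul_pos hε hx
      refine pos_of_mul_pos_right (a := Complex.normSq (D.velocity (shift α s')) *
        (planeDet (D.velocity α) (deriv γ 0) * planeDet (D.velocity α) (deriv γ 0))) ?_
        (mul_nonneg hns.le (mul_self_nonneg _))
      linarith
    refine ⟨C.isRegular h0 hs' (fun _ h => ?_), ?_, ?_⟩
    · rw [h, mul_zero] at hσs
      exact lt_irrefl _ hσs
    · refine C.touches hγs h0 hs' _ hU (hR σ ε) fun q hqU hq _ hy => ⟨hq, hqU, ?_⟩
      rw [planeDet_I_mul_self] at hy
      exact hkey _ (hy hns.ne')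
    · refine C.touches hγs h0 hs' _ hU (hR σ (-ε)) fun q hqU hq _ hy => ⟨hq, hqU, ?_⟩
      have e1 : planeDet (D.velocity (shift α s')) (-(Complex.I * D.velocity (shift α s'))) =
          -Complex.normSq (D.velocity (shift α s')) := by
        rw [← planeDet_I_mul_self]; simp [planeDet]; ring
      rw [e1] at hy
      have := hkey (-q.2) (by linarith [hy (neg_ne_zero.2 hns.ne')])
      push_cast
      linarith
  · filter_upwards [C.eventually_mem_image h0] with z ⟨q, hq, hz⟩ hzi
    have hq1 : q.1 ≠ 0 := fun h => by
      refine hzi ⟨shift β q.2, ?_⟩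
      rw [← hz, C.apply, h, shift_zero]
      ring
    have hq2 : q.2 ≠ 0 := fun h => by
      refine hzi ⟨shift α q.1, ?_⟩
      rw [← hz, C.apply, h, h0]
      ring
    obtain ⟨σ, hσ⟩ := units_int_mul_pos_cases _ hq1
    obtain ⟨τ, hτ⟩ := units_int_mul_pos_cases _ hq2
    exact ⟨σ, τ, hz ▸ hR σ τ q ⟨hq, hσ, hτ⟩⟩

end LinkDiagram

namespace LinkDiagram

variable {l : ℕ} {X : Type*} [TopologicalSpace X] {D : LinkDiagram l} {ι : ℂ → X}

/-! ### Functions on the set of regions -/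

/-- The properties of the placement of the plane on a surface that are used below: regions meet
the plane, and a locally constant function on the complement of a compact subset of the plane that
vanishes near infinity is constant on regions. -/
structure PlaneEmbedding (ι : ℂ → X) : Prop where
  continuous : Continuous ι
  injective : Function.Injective ι
  exists_mem : ∀ K : Set ℂ, IsCompact K → ∀ p ∈ (ι '' K)ᶜ,
    ∃ z, ι z ∈ connectedComponentIn (ι '' K)ᶜ p
  eq_of_mem : ∀ K : Set ℂ, IsCompact K → ∀ f : ℂ → ℤ, (∀ z ∉ K, ∀ᶠ y in 𝓝 z, f y = f z) →
    (∀ᶠ z in cocompact ℂ, f z = 0) → ∀ p z z', ι z ∈ connectedComponentIn (ι '' K)ᶜ p →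
      ι z' ∈ connectedComponentIn (ι '' K)ᶜ p → f z = f z'

theorem PlaneEmbedding.exists_mem_region (hι : PlaneEmbedding ι) (R : D.Region ι) :
    ∃ z, ι z ∈ R.1 := by
  obtain ⟨_, p, hp, rfl⟩ := R
  exact hι.exists_mem _ D.isCompact_image p hp

/-- A function on the plane, viewed as a function on regions. -/
noncomputable def regionFun (hι : PlaneEmbedding ι) (f : ℂ → ℤ) (R : D.Region ι) : ℤ :=
  f (hι.exists_mem_region R).choose

theorem regionFun_eq (hι : PlaneEmbedding ι) {f : ℂ → ℤ}
    (hf : ∀ z ∉ D.image, ∀ᶠ y in 𝓝 z, f y = f z) (hf0 : ∀ᶠ z in cocompact ℂ, f z = 0)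
    {R : D.Region ι} {z : ℂ} (hz : ι z ∈ R.1) : regionFun hι f R = f z := by
  have h := (hι.exists_mem_region R).choose_spec
  rw [regionFun]
  obtain ⟨_, p, hp, rfl⟩ := R
  exact hι.eq_of_mem _ D.isCompact_image f hf hf0 p _ _ h hz

/-- Exchanging the strands negates the determinant, hence replaces `ε` by `-ε`. Both descriptions
name the same four regions, because at most one region lies next to a point in a given direction. -/
theorem exists_corners_swap (hι : Continuous ι) (hinj : Function.Injective ι)
    {α β : Fin l × UnitAddCircle} (hne : α ≠ β) (hp : D.point α = D.point β) :
    ∃ ε : ℤˣ, 0 < ((ε : ℤ) : ℝ) * planeDet (D.velocity α) (D.velocity β) ∧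
    ∃ R : ℤˣ → ℤˣ → D.Region ι,
      (∀ σ τ : ℤˣ, D.Touches ι (D.point α)
        (((σ : ℤ) : ℂ) * D.velocity α + ((τ : ℤ) : ℂ) * D.velocity β) (R σ τ)) ∧
      (∀ σ : ℤˣ, ∀ᶠ s : ℝ in 𝓝[>] 0, D.IsRegular (shift α ((σ : ℤ) * s)) ∧
        D.Touches ι (D.point (shift α ((σ : ℤ) * s)))
          (Complex.I * D.velocity (shift α ((σ : ℤ) * s))) (R σ ε) ∧
        D.Touches ι (D.point (shift α ((σ : ℤ) * s)))
          (-(Complex.I * D.velocity (shift α ((σ : ℤ) * s)))) (R σ (-ε))) ∧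
      (∀ τ : ℤˣ, ∀ᶠ s : ℝ in 𝓝[>] 0, D.IsRegular (shift β ((τ : ℤ) * s)) ∧
        D.Touches ι (D.point (shift β ((τ : ℤ) * s)))
          (Complex.I * D.velocity (shift β ((τ : ℤ) * s))) (R (-ε) τ) ∧
        D.Touches ι (D.point (shift β ((τ : ℤ) * s)))
          (-(Complex.I * D.velocity (shift β ((τ : ℤ) * s)))) (R ε τ)) ∧
      ∀ᶠ z in 𝓝 (D.point α), z ∉ D.image → ∃ σ τ, ι z ∈ (R σ τ).1 := by
  obtain ⟨ε, hε⟩ := units_int_mul_pos_cases _ (D.planeDet_velocity_ne_zero hne hp)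
  obtain ⟨R, hR, hα, hz⟩ := exists_corners hι hinj hne hp hε
  obtain ⟨R', hR', hβ, -⟩ := exists_corners hι hinj hne.symm hp.symm (ε := -ε) (by
    rw [planeDet_swap]
    push_cast
    linarith)
  have hRR : ∀ σ τ, R' τ σ = R σ τ := fun σ τ => by
    refine Touches.unique D ι (hR' τ σ) ?_
    rw [← hp, add_comm]
    exact hR σ τ
  simp only [hRR, neg_neg] at hβ
  exact ⟨ε, hε, R, hR, hα, hβ, hz⟩

/-! ### Regular points and functions without jumps -/

theorem exists_ne_of_not_isRegular {α : Fin l × UnitAddCircle} (h : ¬ D.IsRegular α) :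
    ∃ β, α ≠ β ∧ D.point α = D.point β := by
  simp only [IsRegular, not_forall] at h
  obtain ⟨β, hβ, hne⟩ := h
  exact ⟨β, Ne.symm hne, hβ.symm⟩

/-- Every component has a regular point, with regions on its two sides. -/
theorem exists_isRegular (hι : Continuous ι) (hinj : Function.Injective ι) (i : Fin l) :
    ∃ α : Fin l × UnitAddCircle, α.1 = i ∧ D.IsRegular α ∧ ∃ L R : D.Region ι,
      D.Touches ι (D.point α) (Complex.I * D.velocity α) L ∧
      D.Touches ι (D.point α) (-(Complex.I * D.velocity α)) R := by
  by_cases h : D.IsRegular (i, 0)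
  · obtain ⟨L, R, hLR, -⟩ := exists_sides hι hinj h
    obtain ⟨h1, h2, h3⟩ := hLR.self_of_nhds
    exact ⟨_, rfl, h1, L, R, h2, h3⟩
  · obtain ⟨β, hne, hp⟩ := exists_ne_of_not_isRegular h
    obtain ⟨ε, -, R, -, hα, -⟩ := exists_corners_swap hι hinj hne hp
    obtain ⟨s, h1, h2, h3⟩ := (hα 1).exists
    exact ⟨_, rfl, h1, _, _, h2, h3⟩

/-- A function on regions that does not jump along the diagram is constant near every point. -/
theorem exists_eventually_eq (hι : Continuous ι) (hinj : Function.Injective ι)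
    {u : D.Region ι → ℤ}
    (hu : ∀ α, D.IsRegular α → ∀ L R : D.Region ι,
      D.Touches ι (D.point α) (Complex.I * D.velocity α) L →
      D.Touches ι (D.point α) (-(Complex.I * D.velocity α)) R → u L = u R) (p : ℂ) :
    p ∈ closure D.imageᶜ ∧ ∃ c, ∀ᶠ z in 𝓝 p, ∀ S : D.Region ι, ι z ∈ S.1 → u S = c := by
  have hcl : ∀ (d : ℂ) (R : D.Region ι), D.Touches ι p d R → p ∈ closure D.imageᶜ := by
    intro d R hR
    have hc : Continuous fun h : ℝ => p + h * d := by fun_prop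
    have ht : Tendsto (fun h : ℝ => p + h * d) (𝓝[>] 0) (𝓝 p) := by
      simpa using (hc.tendsto 0).mono_left nhdsWithin_le_nhds
    exact mem_closure_of_tendsto ht (hR.mono fun h hh => Region.notMem_image hh)
  by_cases hp : p ∈ D.image
  · obtain ⟨α, rfl⟩ := hp
    by_cases hα : D.IsRegular α
    · obtain ⟨L, R, hLR, hz⟩ := exists_sides hι hinj hα
      obtain ⟨-, h2, h3⟩ := hLR.self_of_nhds
      rw [shift_zero] at h2 h3
      refine ⟨hcl _ _ h2, u L, hz.mono fun z hz S hS => ?_⟩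
      rcases hz (Region.notMem_image hS) with h | h
      · rw [Region.eq_of_mem hS h]
      · rw [Region.eq_of_mem hS h, hu α hα L R h2 h3]
    · obtain ⟨β, hne, hp⟩ := exists_ne_of_not_isRegular hα
      obtain ⟨ε, -, R, hR, h1, h2, hz⟩ := exists_corners_swap hι hinj hne hp
      -- Crossing the four half-strands links the four corners in a cycle, so all four values agree.
      have e1 : ∀ σ, u (R σ ε) = u (R σ (-ε)) := fun σ => by
        obtain ⟨s, i1, i2, i3⟩ := (h1 σ).exists
        exact hu _ i1 _ _ i2 i3
      have e2 : ∀ τ, u (R (-ε) τ) = u (R ε τ) := fun τ => by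
        obtain ⟨s, i1, i2, i3⟩ := (h2 τ).exists
        exact hu _ i1 _ _ i2 i3
      have hcase : ∀ σ : ℤˣ, σ = ε ∨ σ = -ε := fun σ => by
        rcases Int.units_eq_one_or σ with rfl | rfl <;>
        rcases Int.units_eq_one_or ε with rfl | rfl <;> simp
      refine ⟨hcl _ _ (hR 1 1), u (R ε ε), hz.mono fun z hz S hS => ?_⟩
      obtain ⟨σ, τ, h⟩ := hz (Region.notMem_image hS)
      rw [Region.eq_of_mem hS h]
      rcases hcase σ with rfl | rfl <;> rcases hcase τ with rfl | rfl
      · rfl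
      · exact (e1 _).symm
      · exact e2 _
      · exact (e1 _).symm.trans (e2 _)
  · obtain ⟨r, hr, hball⟩ := Metric.isOpen_iff.1 D.isCompact_image.isClosed.isOpen_compl p hp
    obtain ⟨R, hR⟩ := exists_region_of_isPreconnected (D := D) hι hinj
      (convex_ball p r).isPreconnected ⟨p, Metric.mem_ball_self hr⟩ hball
    refine ⟨subset_closure hp, u R, ?_⟩
    filter_upwards [Metric.ball_mem_nhds p hr] with z hz S hS
    rw [Region.eq_of_mem hS (hR z hz)]

/-- A function on regions that does not jump along the diagram is constant. -/
theorem eq_of_forall_touches (hι : PlaneEmbedding ι) {u : D.Region ι → ℤ}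
    (hu : ∀ α, D.IsRegular α → ∀ L R : D.Region ι,
      D.Touches ι (D.point α) (Complex.I * D.velocity α) L →
      D.Touches ι (D.point α) (-(Complex.I * D.velocity α)) R → u L = u R)
    (R S : D.Region ι) : u R = u S := by
  choose hcl c hc using exists_eventually_eq hι.continuous hι.injective hu
  have hloc : IsLocallyConstant c := by
    rw [IsLocallyConstant.iff_eventually_eq]
    intro p
    filter_upwards [eventually_eventually_nhds.2 (hc p)] with q hq
    -- The complement of the diagram is dense, so some point off the diagram is close enough to
    -- compare `c q` with `c p`.
    have hne : (𝓝[D.imageᶜ] q).NeBot := mem_closure_iff_nhdsWithin_neBot.1 (hcl q)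
    obtain ⟨z, ⟨h1, h2⟩, h3⟩ := ((eventually_nhdsWithin_of_eventually_nhds
      (s := D.imageᶜ) (hq.and (hc q))).and self_mem_nhdsWithin).exists
    have hm := mem_regionOf (D := D) hι.injective h3
    rw [← h1 _ hm, ← h2 _ hm]
  have hval : ∀ (T : D.Region ι) (z : ℂ), ι z ∈ T.1 → u T = c z := fun T z hz =>
    (hc z).self_of_nhds T hz
  obtain ⟨z, hz⟩ := hι.exists_mem_region R
  obtain ⟨z', hz'⟩ := hι.exists_mem_region S
  rw [hval R z hz, hval S z' hz']
  exact hloc.apply_eq_of_preconnectedSpace z z'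

/-! ### Componentwise Alexander numberings from winding numbers -/

/-- The winding number of a component of the link about a point of the plane. -/
noncomputable def windingInt (D : LinkDiagram l) (i : Fin l) (z : ℂ) : ℤ :=
  round (windingNumber (fun t => D.point (shift (i, 0) t)) z).re

theorem range_curve_shift_subset (D : LinkDiagram l) (α : Fin l × UnitAddCircle) :
    range (fun t => D.point (shift α t)) ⊆ range (D.curve α.1) := by
  rintro _ ⟨t, rfl⟩
  exact ⟨_, rfl⟩

theorem range_curve_subset (D : LinkDiagram l) (i : Fin l) : range (D.curve i) ⊆ D.image := by
  rintro _ ⟨θ, rfl⟩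
  exact ⟨(i, θ), rfl⟩

theorem contDiff_one_curve_shift (D : LinkDiagram l) (α : Fin l × UnitAddCircle) :
    ContDiff ℝ 1 fun t => D.point (shift α t) :=
  (D.contDiff_curve_shift α).of_le (by exact_mod_cast le_top)

theorem coe_windingInt (D : LinkDiagram l) {i : Fin l} {z : ℂ} (hz : z ∉ range (D.curve i)) :
    (D.windingInt i z : ℂ) = windingNumber (fun t => D.point (shift (i, 0) t)) z := by
  obtain ⟨n, hn⟩ := exists_int_windingNumber (D.contDiff_one_curve_shift (i, 0))
    (by simpa using D.periodic_curve_shift (i, 0) 0)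
    fun h => hz (D.range_curve_shift_subset (i, 0) h)
  rw [windingInt, hn]
  simp

/-- Off the component the winding number is continuous and integral, and integers at distance less
than one are equal. -/
theorem eventually_windingInt_eq (D : LinkDiagram l) {i : Fin l} {z : ℂ}
    (hz : z ∉ range (D.curve i)) : ∀ᶠ y in 𝓝 z, D.windingInt i y = D.windingInt i z := by
  have hcl : IsClosed (range (D.curve i)) := (isCompact_range (D.continuous_curve i)).isClosed
  have hc := continuousAt_windingNumber (D.contDiff_one_curve_shift (i, 0))
    fun h => hz (D.range_curve_shift_subset (i, 0) h)
  filter_upwards [hcl.isOpen_compl.mem_nhds hz, Metric.tendsto_nhds.1 hc.tendsto 1 one_pos]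
    with y hy hd
  rw [← D.coe_windingInt hy, ← D.coe_windingInt hz, dist_eq_norm, ← Int.cast_sub,
    Complex.norm_intCast] at hd
  norm_cast at hd
  have := Int.abs_lt_one_iff.1 hd
  omega

theorem eventually_windingInt_eq_zero (D : LinkDiagram l) (i : Fin l) :
    ∀ᶠ z in cocompact ℂ, D.windingInt i z = 0 := by
  filter_upwards [(isCompact_range (D.continuous_curve i)).compl_mem_cocompact,
    Metric.tendsto_nhds.1
      (tendsto_windingNumber_cocompact (D.contDiff_one_curve_shift (i, 0))) 1 one_pos] with y hy hd
  rw [← D.coe_windingInt hy, dist_eq_norm, sub_zero, Complex.norm_intCast] at hd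
  norm_cast at hd
  exact Int.abs_lt_one_iff.1 hd

end LinkDiagram

/-- Independence of the base point allows the jump formula, proved at parameter `0`, to be used at
every point of a component. -/
theorem windingNumber_comp_const_add {γ : ℝ → ℂ} (hper : Function.Periodic γ 1) (t₀ : ℝ) (z : ℂ) :
    windingNumber (fun t => γ (t₀ + t)) z = windingNumber γ z := by
  have hdper : Function.Periodic (deriv γ) 1 := fun t => by
    rw [← deriv_comp_add_const]
    exact congrArg (fun f => deriv f t) (funext hper)
  have hp : Function.Periodic (fun t => deriv γ t / (γ t - z)) 1 := fun t => by
    simp only [hper t, hdper t]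
  have h1 : ∀ t, deriv (fun t => γ (t₀ + t)) t = deriv γ (t₀ + t) := fun t =>
    deriv_comp_const_add (f := γ) t₀ t
  simp only [windingNumber, h1]
  rw [intervalIntegral.integral_comp_add_left (fun t => deriv γ t / (γ t - z)) t₀, add_zero,
    hp.intervalIntegral_add_eq t₀ 0, zero_add]

namespace LinkDiagram

variable {l : ℕ} {X : Type*} [TopologicalSpace X] {D : LinkDiagram l} {ι : ℂ → X}

theorem windingNumber_shift (D : LinkDiagram l) (α : Fin l × UnitAddCircle) (z : ℂ) :
    windingNumber (fun t => D.point (shift α t)) z =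
      windingNumber (fun t => D.point (shift (α.1, 0) t)) z := by
  obtain ⟨i, θ⟩ := α
  obtain ⟨t₀, rfl⟩ := QuotientAddGroup.mk_surjective θ
  rw [← windingNumber_comp_const_add (D.periodic_curve_shift (i, 0)) t₀]
  congr 1
  funext t
  simp [shift]

/-- The winding number jumps by one across the component itself and is constant across the
others. -/
theorem windingInt_sub_eq {α : Fin l × UnitAddCircle} (hα : D.IsRegular α) (i : Fin l)
    {L R : D.Region ι} (hL : D.Touches ι (D.point α) (Complex.I * D.velocity α) L)
    (hR : D.Touches ι (D.point α) (-(Complex.I * D.velocity α)) R) :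
    ∃ z z', ι z ∈ L.1 ∧ ι z' ∈ R.1 ∧
      D.windingInt i z = D.windingInt i z' + if α.1 = i then 1 else 0 := by
  have hpath : ∀ d : ℂ, Tendsto (fun h : ℝ => D.point α + h * d) (𝓝[>] 0) (𝓝 (D.point α)) := by
    intro d
    have hc : Continuous fun h : ℝ => D.point α + h * d := by fun_prop
    simpa using (hc.tendsto 0).mono_left nhdsWithin_le_nhds
  split_ifs with hi
  · subst hi
    have hd : deriv (fun t => D.point (shift α t)) 0 = D.velocity α := by
      rw [deriv_curve_shift, shift_zero]
    have ht := tendsto_windingNumber_sub (D.contDiff_one_curve_shift α)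
      (D.periodic_curve_shift α) (by rw [hd]; exact D.velocity_ne_zero α) fun t ht => by
        have h1 := hα (shift α t) (by simpa using ht)
        have h2 : (t : UnitAddCircle) = 0 := by simpa [shift, Prod.ext_iff] using h1
        obtain ⟨n, hn⟩ := (AddCircle.coe_eq_zero_iff (1 : ℝ)).1 h2
        exact ⟨n, by simpa using hn.symm⟩
    rw [hd, shift_zero] at ht
    obtain ⟨h, ⟨h1, h2⟩, h3⟩ := ((hL.and hR).and (Metric.tendsto_nhds.1 ht 1 one_pos)).exists
    refine ⟨_, _, h1, h2, ?_⟩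
    have n1 := fun h => Region.notMem_image h1 (D.range_curve_subset α.1 h)
    have n2 := fun h => Region.notMem_image h2 (D.range_curve_subset α.1 h)
    rw [D.windingNumber_shift α, D.windingNumber_shift α, ← D.coe_windingInt n1, ← D.coe_windingInt n2,
      dist_eq_norm, ← Int.cast_sub, ← Int.cast_one, ← Int.cast_sub, Complex.norm_intCast] at h3
    norm_cast at h3
    have := Int.abs_lt_one_iff.1 h3
    omega
  · have hn : D.point α ∉ range (D.curve i) := by
      rintro ⟨θ, hθ⟩
      exact hi (congrArg Prod.fst (hα (i, θ) hθ)).symm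
    have he := D.eventually_windingInt_eq hn
    obtain ⟨h, ⟨h1, h2⟩, h3, h4⟩ := ((hL.and hR).and (((hpath _).eventually he).and
      ((hpath _).eventually he))).exists
    exact ⟨_, _, h1, h2, by rw [h3, h4, add_zero]⟩

/-- The winding numbers of a component, as a function on regions. -/
noncomputable def windingFun (D : LinkDiagram l) (hι : PlaneEmbedding ι) (i : Fin l) :
    D.Region ι → ℤ := regionFun hι (D.windingInt i)

theorem windingFun_eq (hι : PlaneEmbedding ι) (i : Fin l) {R : D.Region ι} {z : ℂ}
    (hz : ι z ∈ R.1) : D.windingFun hι i R = D.windingInt i z :=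
  regionFun_eq hι (fun _ hz => D.eventually_windingInt_eq fun h => hz (D.range_curve_subset i h))
    (D.eventually_windingInt_eq_zero i) hz

theorem windingFun_jump (hι : PlaneEmbedding ι) (i : Fin l) {α : Fin l × UnitAddCircle}
    (hα : D.IsRegular α) {L R : D.Region ι}
    (hL : D.Touches ι (D.point α) (Complex.I * D.velocity α) L)
    (hR : D.Touches ι (D.point α) (-(Complex.I * D.velocity α)) R) :
    D.windingFun hι i L = D.windingFun hι i R + if α.1 = i then 1 else 0 := by
  obtain ⟨z, z', h1, h2, h3⟩ := windingInt_sub_eq hα i hL hR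
  rw [windingFun_eq hι i h1, windingFun_eq hι i h2, h3]

theorem exists_component_region (i : Fin l) (R : D.Region ι) :
    ∃ S : (D.component i).Region ι, R.1 ⊆ S.1 := by
  have himage : (D.component i).image ⊆ D.image := by
    rintro _ ⟨β, rfl⟩
    exact ⟨(i, β.2), rfl⟩
  obtain ⟨_, p, hp, rfl⟩ := R
  have hsub : (ι '' D.image)ᶜ ⊆ (ι '' (D.component i).image)ᶜ :=
    compl_subset_compl.2 (image_mono himage)
  exact ⟨⟨_, p, hsub hp, rfl⟩, connectedComponentIn_mono p hsub⟩

/-- The standard kernel solution of a component is given by winding numbers. -/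
theorem isStandardKernelSolution_iff (hι : PlaneEmbedding ι) {Rinf : D.Region ι}
    (hinf : ∀ᶠ z in cocompact ℂ, ι z ∈ Rinf.1) (i : Fin l) (u : D.Region ι → ℤ) :
    D.IsStandardKernelSolution ι Rinf i u ↔ u = D.windingFun hι i := by
  have hw : ∀ (R : D.Region ι) (S : (D.component i).Region ι), R.1 ⊆ S.1 →
      D.windingFun hι i R = (D.component i).windingFun hι 0 S := by
    intro R S hRS
    obtain ⟨z, hz⟩ := hι.exists_mem_region R
    rw [windingFun_eq hι i hz, windingFun_eq hι 0 (hRS hz)]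
    rfl
  have hw0 : D.windingFun hι i Rinf = 0 := by
    obtain ⟨z, h1, h2⟩ := (hinf.and (D.eventually_windingInt_eq_zero i)).exists
    rw [windingFun_eq hι i h1, h2]
  constructor
  · rintro ⟨⟨a, ha, hua⟩, h0⟩
    -- Both numberings jump by one along the component, so their difference is constant; its value
    -- on the region containing `Rinf` is zero.
    have hconst := eq_of_forall_touches (D := D.component i) hι
      (u := fun S => a S - (D.component i).windingFun hι 0 S) fun α hα L R hL hR => by
        have h1 := ha α hα L R hL hR
        have h2 := windingFun_jump (D := D.component i) hι 0 hα hL hR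
        rw [if_pos (Subsingleton.elim _ _)] at h2
        omega
    funext R
    obtain ⟨S, hS⟩ := exists_component_region i R
    obtain ⟨S', hS'⟩ := exists_component_region i Rinf
    have h1 := hconst S S'
    rw [← hua R S hS, ← hw R S hS, ← hua Rinf S' hS', ← hw Rinf S' hS', h0, hw0] at h1
    omega
  · rintro rfl
    refine ⟨⟨(D.component i).windingFun hι 0, fun α hα L R hL hR => ?_, hw⟩, hw0⟩
    have h2 := windingFun_jump (D := D.component i) hι 0 hα hL hR
    rwa [if_pos (Subsingleton.elim _ _)] at h2

end LinkDiagram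

namespace LinkDiagram

variable {l : ℕ} {X : Type*} [TopologicalSpace X] {D : LinkDiagram l} {ι : ℂ → X}

/-! ### The kernel equation at a crossing -/

theorem Crossing.overPt_ne_underPt (x : D.Crossing) : x.overPt ≠ x.underPt :=
  fun h => x.underPt_notMem (h ▸ x.overPt_mem)

/-- With `v`, `w` the velocities of the overpass and the underpass, the imaginary part in
`PosCorner` is `-(σ * τ * planeDet v w)`, and `ε` is the sign of the determinant. -/
theorem posCorner_iff (x : D.Crossing) {ε : ℤˣ}
    (hε : 0 < ((ε : ℤ) : ℝ) * planeDet (D.velocity x.overPt) (D.velocity x.underPt))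
    (σ τ : ℤˣ) : D.PosCorner x (σ, τ) ↔ τ = -(ε * σ) := by
  have h1 : (star (((τ : ℤ) : ℂ) * D.velocity x.underPt) *
      (((σ : ℤ) : ℂ) * D.velocity x.overPt)).im =
      -(((σ : ℤ) : ℝ) * ((τ : ℤ) : ℝ) *
        planeDet (D.velocity x.overPt) (D.velocity x.underPt)) := by
    rcases Int.units_eq_one_or σ with rfl | rfl <;>
    rcases Int.units_eq_one_or τ with rfl | rfl <;>
    · simp [planeDet]; ring
  rw [PosCorner, h1]
  generalize planeDet (D.velocity x.overPt) (D.velocity x.underPt) = y at hε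
  rcases Int.units_eq_one_or σ with rfl | rfl <;>
  rcases Int.units_eq_one_or τ with rfl | rfl <;>
  rcases Int.units_eq_one_or ε with rfl | rfl <;>
  · simp at hε ⊢; linarith

theorem finsum_ite_eq_mul {R : Type*} (a : R) (u : R → ℤ) [DecidableEq R] :
    ∑ᶠ b, (if b = a then (1 : ℤ) else 0) * u b = u a := by
  rw [finsum_eq_single _ a fun b hb => by rw [if_neg hb, zero_mul], if_pos rfl, one_mul]

open Classical in
-- The four regions need not be distinct: a sum of indicators counts coincidences with multiplicity.
theorem phi_apply (x : D.Crossing) (u : D.Region ι → ℤ) {A B E F : D.Region ι}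
    (h : ∀ R, D.matrixA2 ι x R = (if R = A then 1 else 0) + (if R = B then 1 else 0) -
      (if R = E then 1 else 0) - (if R = F then 1 else 0)) :
    D.Phi ι u x = u A + u B - u E - u F := by
  have hfin : ∀ a : D.Region ι,
      (Function.support fun b => (if b = a then (1 : ℤ) else 0) * u b).Finite := fun a =>
    (finite_singleton a).subset fun b hb => by
      by_contra hne
      exact hb (by simp only; rw [if_neg (by simpa using hne), zero_mul])
  change ∑ᶠ R, D.matrixA2 ι x R * u R = _
  simp only [h, sub_mul, add_mul]
  rw [finsum_sub_distrib, finsum_sub_distrib, finsum_add_distrib (hfin A) (hfin B),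
    finsum_ite_eq_mul, finsum_ite_eq_mul, finsum_ite_eq_mul, finsum_ite_eq_mul]
  · exact ((hfin A).union (hfin B)).subset (Function.support_add _ _)
  · exact hfin E
  · exact (((hfin A).union (hfin B)).subset (Function.support_add _ _)).union (hfin E) |>.subset
      (Function.support_sub _ _)
  · exact hfin F

open Classical in
-- By `h₁` and `h₂` adjacent corners lie in different regions, so only opposite corners, which have
-- equal signs, can share one. The doubled entry is then the sum of the two corner signs.
theorem matrixA2_apply (x : D.Crossing) {R : ℤˣ → ℤˣ → D.Region ι} {ε : ℤˣ}
    (hε : 0 < ((ε : ℤ) : ℝ) * planeDet (D.velocity x.overPt) (D.velocity x.underPt))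
    (hR : ∀ σ τ : ℤˣ, D.Touches ι (D.point x.overPt)
      (((σ : ℤ) : ℂ) * D.velocity x.overPt + ((τ : ℤ) : ℂ) * D.velocity x.underPt) (R σ τ))
    (h₁ : ∀ σ, R σ ε ≠ R σ (-ε)) (h₂ : ∀ τ, R (-ε) τ ≠ R ε τ) (S : D.Region ι) :
    D.matrixA2 ι x S = (if S = R ε (-1) then 1 else 0) + (if S = R (-ε) 1 then 1 else 0) -
      (if S = R ε 1 then 1 else 0) - (if S = R (-ε) (-1) then 1 else 0) := by
  have ht : ∀ c : ℤˣ × ℤˣ, D.TouchesCorner ι x c S ↔ S = R c.1 c.2 := fun c =>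
    ⟨fun h => Touches.unique D ι h (hR c.1 c.2), fun h => h ▸ hR c.1 c.2⟩
  have hex : ∀ P : ℤˣ × ℤˣ → Prop, (∃ c, P c) ↔
      P (ε, 1) ∨ P (ε, -1) ∨ P (-ε, 1) ∨ P (-ε, -1) := by
    intro P
    constructor
    · rintro ⟨⟨σ, τ⟩, h⟩
      rcases Int.units_eq_one_or σ with rfl | rfl <;>
      rcases Int.units_eq_one_or τ with rfl | rfl <;>
      rcases Int.units_eq_one_or ε with rfl | rfl <;> simp_all
    · rintro (h | h | h | h) <;> exact ⟨_, h⟩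
  have d1 : R ε 1 ≠ R ε (-1) := by
    rcases Int.units_eq_one_or ε with rfl | rfl
    · exact h₁ 1
    · exact fun h => h₁ (-1) (by simpa using h.symm)
  have d2 : R (-ε) 1 ≠ R (-ε) (-1) := by
    rcases Int.units_eq_one_or ε with rfl | rfl
    · exact h₁ (-1)
    · exact fun h => h₁ 1 (by simpa using h.symm)
  have d3 := h₂ 1
  have d4 := h₂ (-1)
  have hεε : ε * ε = 1 := Int.units_mul_self ε
  have hp := posCorner_iff x hε
  have e1 : ((1 : ℤˣ) = -1) ↔ False := by decide
  have e2 : ((-1 : ℤˣ) = 1) ↔ False := by decide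
  simp only [matrixA2, matrixA1, Matrix.of_apply, hex, ht, hp, Prod.neg_mk, mul_neg, hεε,
    neg_neg, e1, e2, false_and, true_and, not_true, not_false_eq_true, false_or, or_false]
  by_cases a1 : S = R ε 1 <;> by_cases a2 : S = R ε (-1) <;>
  by_cases a3 : S = R (-ε) 1 <;> by_cases a4 : S = R (-ε) (-1) <;>
  simp only [a1, a2, a3, a4] at * <;> simp_all

/-- At a crossing, the kernel equation says that the alternating sum over the corners vanishes. -/
theorem phi_apply_eq_zero_iff (hι : PlaneEmbedding ι) (x : D.Crossing) (u : D.Region ι → ℤ)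
    {R : ℤˣ → ℤˣ → D.Region ι}
    (hR : ∀ σ τ : ℤˣ, D.Touches ι (D.point x.overPt)
      (((σ : ℤ) : ℂ) * D.velocity x.overPt + ((τ : ℤ) : ℂ) * D.velocity x.underPt) (R σ τ)) :
    D.Phi ι u x = 0 ↔ u (R 1 1) + u (R (-1) (-1)) = u (R 1 (-1)) + u (R (-1) 1) := by
  obtain ⟨ε, hε, R', hR', h₁, h₂, -⟩ := exists_corners_swap hι.continuous hι.injective
    x.overPt_ne_underPt x.point_eq
  have hRR : R' = R := by
    funext σ τ
    exact Touches.unique D ι (hR' σ τ) (hR σ τ)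
  subst hRR
  -- The two sides of an arc are different regions, because the winding number of its component
  -- differs by one.
  have hjump : ∀ α, D.IsRegular α → ∀ L R : D.Region ι,
      D.Touches ι (D.point α) (Complex.I * D.velocity α) L →
      D.Touches ι (D.point α) (-(Complex.I * D.velocity α)) R → L ≠ R := by
    rintro α hα L R hL hR rfl
    have := windingFun_jump hι α.1 hα hL hR
    rw [if_pos rfl] at this
    omega
  have n₁ : ∀ σ, R' σ ε ≠ R' σ (-ε) := fun σ => by
    obtain ⟨s, i1, i2, i3⟩ := (h₁ σ).exists
    exact hjump _ i1 _ _ i2 i3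
  have n₂ : ∀ τ, R' (-ε) τ ≠ R' ε τ := fun τ => by
    obtain ⟨s, i1, i2, i3⟩ := (h₂ τ).exists
    exact hjump _ i1 _ _ i2 i3
  rw [phi_apply x u (matrixA2_apply x hε hR n₁ n₂)]
  rcases Int.units_eq_one_or ε with rfl | rfl
  · omega
  · rw [neg_neg]
    omega

/-! ### Jumps of kernel elements -/

/-- The value of `u` on the left of `α` exceeds the value on the right by `d`. -/
def HasJump (u : D.Region ι → ℤ) (α : Fin l × UnitAddCircle) (d : ℤ) : Prop :=
  ∃ L R : D.Region ι, D.Touches ι (D.point α) (Complex.I * D.velocity α) L ∧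
    D.Touches ι (D.point α) (-(Complex.I * D.velocity α)) R ∧ u L = u R + d

theorem HasJump.unique {u : D.Region ι → ℤ} {α : Fin l × UnitAddCircle} {d d' : ℤ}
    (h : HasJump u α d) (h' : HasJump u α d') : d = d' := by
  obtain ⟨L, R, hL, hR, h⟩ := h
  obtain ⟨L', R', hL', hR', h'⟩ := h'
  rw [Touches.unique D ι hL' hL, Touches.unique D ι hR' hR] at h'
  omega

theorem eventually_nhdsNE_of_units {P : ℝ → Prop}
    (h : ∀ σ : ℤˣ, ∀ᶠ s : ℝ in 𝓝[>] 0, P ((σ : ℤ) * s)) : ∀ᶠ s in 𝓝[≠] (0 : ℝ), P s := by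
  rw [← nhdsLT_sup_nhdsGT, eventually_sup]
  constructor
  · have h1 := h (-1)
    have h2 : Tendsto (fun s : ℝ => -s) (𝓝[<] 0) (𝓝[>] 0) := by
      simpa using tendsto_neg_nhdsLT (a := (0 : ℝ))
    refine (h2.eventually h1).mono fun s hs => ?_
    simpa using hs
  · refine (h 1).mono fun s hs => ?_
    simpa using hs

/-- A kernel element has the same jump on the two sides of every point of the link. -/
theorem exists_eventually_hasJump (hι : PlaneEmbedding ι) {u : D.Region ι → ℤ}
    (hu : D.Phi ι u = 0) (α : Fin l × UnitAddCircle) :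
    ∃ d, ∀ᶠ s in 𝓝[≠] (0 : ℝ), HasJump u (shift α s) d := by
  by_cases hα : D.IsRegular α
  · obtain ⟨L, R, hLR, -⟩ := exists_sides hι.continuous hι.injective hα
    exact ⟨u L - u R, nhdsWithin_le_nhds <| hLR.mono fun s hs =>
      ⟨L, R, hs.2.1, hs.2.2, by omega⟩⟩
  · obtain ⟨β, hne, hp⟩ := exists_ne_of_not_isRegular hα
    obtain ⟨ε, -, R, hR, h1, h2, -⟩ := exists_corners_swap hι.continuous hι.injective hne hp
    -- The equation is symmetric in the two strands, so it does not matter whether `α` is the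
    -- overpass or the underpass.
    have key : u (R 1 1) + u (R (-1) (-1)) = u (R 1 (-1)) + u (R (-1) 1) := by
      by_cases ho : α ∈ D.overSet
      · let x : D.Crossing := ⟨α, β, ho, (D.over_under α β hne hp).1 ho, hp⟩
        exact (phi_apply_eq_zero_iff hι x u hR).1 (congrFun hu x)
      · have ho' : β ∈ D.overSet := by
          by_contra h
          exact ho ((D.over_under α β hne hp).2 h)
        let x : D.Crossing := ⟨β, α, ho', ho, hp.symm⟩
        have : u (R 1 1) + u (R (-1) (-1)) = u (R (-1) 1) + u (R 1 (-1)) :=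
          (phi_apply_eq_zero_iff hι x u (R := fun σ τ => R τ σ) fun σ τ => by
          have := hR τ σ
          rw [hp, add_comm] at this
          exact this).1 (congrFun hu x)
        omega
    -- Rearranged, `key` equates the jump across the strand after the crossing with the jump before
    -- it.
    refine ⟨u (R 1 ε) - u (R 1 (-ε)), eventually_nhdsNE_of_units fun σ =>
      (h1 σ).mono fun s hs => ⟨_, _, hs.2.1, hs.2.2, ?_⟩⟩
    rcases Int.units_eq_one_or σ with rfl | rfl <;>
    rcases Int.units_eq_one_or ε with rfl | rfl
    · omega
    · omega
    · omega
    · rw [neg_neg]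
      omega

/-- The jump of a kernel element is constant along each component. -/
theorem exists_jump (hι : PlaneEmbedding ι) {u : D.Region ι → ℤ} (hu : D.Phi ι u = 0)
    (i : Fin l) : ∃ d, ∀ α, α.1 = i → D.IsRegular α → ∀ L R : D.Region ι,
      D.Touches ι (D.point α) (Complex.I * D.velocity α) L →
      D.Touches ι (D.point α) (-(Complex.I * D.velocity α)) R → u L = u R + d := by
  -- Punctured neighbourhoods are used because a double point itself may have no well-defined sides.
  -- The resulting function of `t` is locally constant on the line, hence constant.
  have hex : ∀ t : ℝ, ∃ d, ∀ᶠ s in 𝓝[≠] t, HasJump u (shift (i, 0) s) d := by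
    intro t
    obtain ⟨d, hd⟩ := exists_eventually_hasJump hι hu (shift (i, 0) t)
    refine ⟨d, ?_⟩
    have hmap : Tendsto (fun s => s - t) (𝓝[≠] t) (𝓝[≠] 0) := by
      refine tendsto_nhdsWithin_of_tendsto_nhds_of_eventually_within _ ?_ ?_
      · have : Continuous fun s : ℝ => s - t := by fun_prop
        simpa using (this.tendsto t).mono_left nhdsWithin_le_nhds
      · filter_upwards [self_mem_nhdsWithin] with s hs
        exact sub_ne_zero.2 hs
    refine (hmap.eventually hd).mono fun s hs => ?_
    rwa [shift_shift, add_sub_cancel] at hs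
  choose d hd using hex
  have hloc : IsLocallyConstant d := by
    rw [IsLocallyConstant.iff_eventually_eq]
    intro t
    have h1 : ∀ᶠ s in 𝓝[≠] t, d s = d t := by
      filter_upwards [eventually_eventually_nhdsWithin.2 (hd t), self_mem_nhdsWithin] with s hs hst
      rw [(isOpen_compl_singleton).nhdsWithin_eq hst] at hs
      obtain ⟨s', i1, i2⟩ := ((hd s).and (eventually_nhdsWithin_of_eventually_nhds hs)).exists
      exact i1.unique i2
    rw [eventually_nhdsWithin_iff] at h1
    filter_upwards [h1] with s hs
    by_cases hst : s = t
    · rw [hst]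
    · exact hs hst
  refine ⟨d 0, ?_⟩
  rintro ⟨j, θ⟩ hj hα L R hL hR
  obtain rfl : j = i := hj
  obtain ⟨t, rfl⟩ := QuotientAddGroup.mk_surjective θ
  obtain ⟨L', R', hLR, -⟩ := exists_sides hι.continuous hι.injective hα
  have hαt : ((j, QuotientAddGroup.mk t) : Fin l × UnitAddCircle) = shift (j, 0) t := by
    simp [shift]
  have h0 := hLR.self_of_nhds
  rw [shift_zero] at h0
  obtain rfl := Touches.unique D ι hL h0.2.1
  obtain rfl := Touches.unique D ι hR h0.2.2
  have hmap : Tendsto (fun s => s - t) (𝓝 t) (𝓝 0) := by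
    have : Continuous fun s : ℝ => s - t := by fun_prop
    simpa using this.tendsto t
  obtain ⟨s, i1, i2⟩ := ((hd t).and
    (eventually_nhdsWithin_of_eventually_nhds (hmap.eventually hLR))).exists
  rw [hαt, shift_shift, add_sub_cancel] at i2
  have : HasJump u (shift (j, 0) s) (u L - u R) := ⟨L, R, i2.2.1, i2.2.2, by omega⟩
  have h3 := this.unique i1
  rw [hloc.apply_eq_of_preconnectedSpace t 0] at h3
  omega

/-! ### The basis of the kernel -/

theorem windingFun_mem_ker (hι : PlaneEmbedding ι) (i : Fin l) :
    D.windingFun hι i ∈ LinearMap.ker (D.Phi ι) := by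
  rw [LinearMap.mem_ker]
  funext x
  obtain ⟨ε, -, R, hR, h1, -, -⟩ := exists_corners_swap hι.continuous hι.injective
    x.overPt_ne_underPt x.point_eq
  refine (phi_apply_eq_zero_iff hι x _ hR).2 ?_
  -- The jump across the overpass depends only on its component, so it is the same on both sides of
  -- the crossing.
  have hj : ∀ σ, D.windingFun hι i (R σ ε) = D.windingFun hι i (R σ (-ε)) +
      if x.overPt.1 = i then 1 else 0 := fun σ => by
    obtain ⟨s, i1, i2, i3⟩ := (h1 σ).exists
    exact windingFun_jump hι i i1 i2 i3
  have j1 := hj 1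
  have j2 := hj (-1)
  rcases Int.units_eq_one_or ε with rfl | rfl
  · omega
  · rw [neg_neg] at j1 j2
    omega

theorem one_mem_ker (hι : PlaneEmbedding ι) :
    (fun _ => 1 : D.Region ι → ℤ) ∈ LinearMap.ker (D.Phi ι) := by
  rw [LinearMap.mem_ker]
  funext x
  obtain ⟨ε, -, R, hR, -⟩ := exists_corners_swap hι.continuous hι.injective
    x.overPt_ne_underPt x.point_eq
  exact (phi_apply_eq_zero_iff hι x _ hR).2 rfl

/-- The standard kernel solutions and the constant solution. -/
noncomputable def kernelFamily (D : LinkDiagram l) (hι : PlaneEmbedding ι) :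
    Option (Fin l) → LinearMap.ker (D.Phi ι)
  | none => ⟨_, one_mem_ker hι⟩
  | some i => ⟨_, windingFun_mem_ker hι i⟩

theorem sum_kernelFamily (hι : PlaneEmbedding ι) (g : Option (Fin l) → ℤ) (S : D.Region ι) :
    (∑ o, g o • D.kernelFamily hι o).1 S =
      g none + ∑ i, g (some i) * D.windingFun hι i S := by
  rw [Fintype.sum_option, Submodule.coe_add, Submodule.coe_sum]
  simp [kernelFamily]

theorem sum_windingFun_jump (hι : PlaneEmbedding ι) (g : Fin l → ℤ) {α : Fin l × UnitAddCircle}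
    (hα : D.IsRegular α) {L R : D.Region ι}
    (hL : D.Touches ι (D.point α) (Complex.I * D.velocity α) L)
    (hR : D.Touches ι (D.point α) (-(Complex.I * D.velocity α)) R) :
    ∑ i, g i * D.windingFun hι i L = ∑ i, g i * D.windingFun hι i R + g α.1 := by
  simp [windingFun_jump hι _ hα hL hR, mul_add, Finset.sum_add_distrib]

/-- The jump of a combination across the `i`-th component is the coefficient `g (some i)`, so a
vanishing combination has only its constant term left, and that vanishes too. -/
theorem linearIndependent_kernelFamily (hι : PlaneEmbedding ι) (Rinf : D.Region ι) :
    LinearIndependent ℤ (D.kernelFamily hι) := by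
  rw [Fintype.linearIndependent_iff]
  intro g hg
  have h : ∀ S, g none + ∑ i, g (some i) * D.windingFun hι i S = 0 := fun S => by
    rw [← sum_kernelFamily, hg]
    rfl
  have hsome : ∀ i, g (some i) = 0 := by
    intro i
    obtain ⟨α, rfl, hα, L, R, hL, hR⟩ := exists_isRegular (D := D) hι.continuous hι.injective i
    have h1 := h L
    rw [sum_windingFun_jump hι (fun i => g (some i)) hα hL hR, ← add_assoc, h R, zero_add] at h1
    exact h1
  rintro (_ | i)
  · simpa [hsome] using h Rinf
  · exact hsome i

/-- The jumps `d i` of a kernel element serve as coefficients: the combination of winding numbers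
absorbs all jumps, and the remainder is a constant, read off at `Rinf`. -/
theorem span_kernelFamily (hι : PlaneEmbedding ι) (Rinf : D.Region ι) :
    ⊤ ≤ Submodule.span ℤ (range (D.kernelFamily hι)) := by
  rintro ⟨u, hu⟩ -
  choose d hd using exists_jump hι (LinearMap.mem_ker.1 hu)
  have hconst := eq_of_forall_touches hι
    (u := fun S => u S - ∑ i, d i * D.windingFun hι i S) fun α hα L R hL hR => by
      have h1 := hd α.1 α rfl hα L R hL hR
      have h2 := sum_windingFun_jump hι d hα hL hR
      omega
  rw [Submodule.mem_span_range_iff_exists_fun]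
  refine ⟨fun o => o.elim (u Rinf - ∑ i, d i * D.windingFun hι i Rinf) d, ?_⟩
  apply Subtype.ext
  funext S
  rw [sum_kernelFamily, ← hconst S Rinf]
  simp

theorem exists_basis (hι : PlaneEmbedding ι) {Rinf : D.Region ι}
    (hinf : ∀ᶠ z in cocompact ℂ, ι z ∈ Rinf.1) :
    ∃ b : Module.Basis (Option (Fin l)) ℤ (LinearMap.ker (D.Phi ι)),
      (∀ (i : Fin l) (u : D.Region ι → ℤ),
        D.IsStandardKernelSolution ι Rinf i u ↔ u = (b (some i)).1) ∧
      (b none).1 = fun _ => 1 := by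
  refine ⟨Module.Basis.mk (linearIndependent_kernelFamily hι Rinf) (span_kernelFamily hι Rinf),
    fun i u => ?_, ?_⟩
  · rw [isStandardKernelSolution_iff hι hinf, Module.Basis.mk_apply]
    rfl
  · rw [Module.Basis.mk_apply]
    rfl

end LinkDiagram

/-! ### The plane and the sphere -/

/-- Polar coordinates present the exterior of a disc as a continuous image of a convex set. -/
theorem Complex.isPreconnected_lt_norm (r : ℝ) : IsPreconnected {z : ℂ | r < ‖z‖} := by
  have h : {z : ℂ | r < ‖z‖} =
      (fun q : ℝ × ℝ => (q.1 : ℂ) * Complex.exp (q.2 * Complex.I)) '' (Ioi r ×ˢ univ) := by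
    ext z
    constructor
    · intro hz
      exact ⟨(‖z‖, z.arg), ⟨hz, trivial⟩, Complex.norm_mul_exp_arg_mul_I z⟩
    · rintro ⟨⟨x, y⟩, ⟨hx, -⟩, rfl⟩
      have hx' : r < x := hx
      simp only [mem_ofPred_eq, norm_mul, Complex.norm_exp_ofReal_mul_I, mul_one,
        Complex.norm_real, Real.norm_eq_abs]
      exact hx'.trans_le (le_abs_self x)
  rw [h]
  refine (((convex_Ioi r).prod convex_univ).isPreconnected).image _ ?_
  exact Continuous.continuousOn (by fun_prop)

theorem Complex.eventually_cocompact_lt_norm (r : ℝ) : ∀ᶠ z in cocompact ℂ, r < ‖z‖ :=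
  (tendsto_norm_cocompact_atTop (E := ℂ)).eventually_gt_atTop r

/-- The exterior of a disc stays connected when the infinite point, which lies in its closure, is
added. -/
theorem OnePoint.mem_connectedComponentIn_infty {K : Set ℂ} {r : ℝ}
    (hK : ∀ z ∈ K, ‖z‖ ≤ r) {z : ℂ} (hz : r < ‖z‖) :
    (z : OnePoint ℂ) ∈ connectedComponentIn (((↑) : ℂ → OnePoint ℂ) '' K)ᶜ OnePoint.infty := by
  set S : Set (OnePoint ℂ) := (↑) '' {z : ℂ | r < ‖z‖} with hS
  have hSc : IsPreconnected S :=
    (Complex.isPreconnected_lt_norm r).image _ OnePoint.continuous_coe.continuousOn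
  have hmem : OnePoint.infty ∈ closure S := by
    have ht : Tendsto ((↑) : ℂ → OnePoint ℂ) (cocompact ℂ) (𝓝 OnePoint.infty) := by
      rw [← coclosedCompact_eq_cocompact]
      exact OnePoint.tendsto_coe_infty
    exact mem_closure_of_tendsto ht
      ((Complex.eventually_cocompact_lt_norm r).mono fun z hz => ⟨z, hz, rfl⟩)
  have hT : IsPreconnected (insert OnePoint.infty S) :=
    hSc.subset_closure (subset_insert _ _) (insert_subset hmem subset_closure)
  refine hT.subset_connectedComponentIn (mem_insert _ _) ?_ (mem_insert_of_mem _ ⟨z, hz, rfl⟩)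
  rintro _ (rfl | ⟨y, hy, rfl⟩)
  · rintro ⟨y, -, h⟩
    exact OnePoint.coe_ne_infty y h
  · rintro ⟨x, hx, h⟩
    have hy' : r < ‖y‖ := hy
    rw [OnePoint.coe_injective h] at hx
    exact (hK y hx).not_gt hy'

namespace LinkDiagram

theorem planeEmbedding_id : PlaneEmbedding (id : ℂ → ℂ) where
  continuous := continuous_id
  injective := Function.injective_id
  exists_mem K _ p hp := ⟨p, mem_connectedComponentIn hp⟩
  eq_of_mem K _ f hf _ p z z' hz hz' := by
    rw [image_id] at hz hz'
    refine isPreconnected_connectedComponentIn.constant (fun y hy => ?_) hz hz'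
    have h : f =ᶠ[𝓝 y] fun _ => f y := hf y (connectedComponentIn_subset _ _ hy)
    exact (continuousAt_const.congr h.symm).continuousWithinAt

theorem planeEmbedding_coe : PlaneEmbedding ((↑) : ℂ → OnePoint ℂ) where
  continuous := OnePoint.continuous_coe
  injective := OnePoint.coe_injective
  exists_mem K hK p hp := by
    induction p using OnePoint.rec with
    | infty =>
      obtain ⟨r, hK⟩ := hK.isBounded.exists_norm_le
      obtain ⟨z, hz⟩ := (Complex.eventually_cocompact_lt_norm r).exists
      exact ⟨z, OnePoint.mem_connectedComponentIn_infty hK hz⟩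
    | coe z => exact ⟨z, mem_connectedComponentIn hp⟩
  eq_of_mem K _ f hf hf0 p z z' hz hz' := by
    -- Extension by `0` is continuous at the infinite point because `f` vanishes near infinity.
    set g : OnePoint ℂ → ℤ := fun x => x.elim 0 f with hg
    change g z = g z'
    refine isPreconnected_connectedComponentIn.constant (fun y hy => ?_) hz hz'
    refine ContinuousAt.continuousWithinAt ?_
    induction y using OnePoint.rec with
    | infty =>
      rw [OnePoint.continuousAt_infty', coclosedCompact_eq_cocompact]
      exact tendsto_const_nhds.congr' (hf0.mono fun z hz => hz.symm)
    | coe y =>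
      rw [OnePoint.continuousAt_coe]
      have h : f =ᶠ[𝓝 y] fun _ => f y :=
        hf y fun hyK => connectedComponentIn_subset _ _ hy ⟨y, hyK, rfl⟩
      exact continuousAt_const.congr h.symm

variable {l : ℕ}

/-- The exterior of a disc containing the diagram is connected, so it lies in one region; every
other region is inside the closed disc. -/
theorem exists_unbounded_region (D : LinkDiagram l) :
    ∃ Rinf : D.Region (id : ℂ → ℂ), (∀ᶠ z in cocompact ℂ, id z ∈ Rinf.1) ∧
      ∀ R : D.Region (id : ℂ → ℂ), ¬ Bornology.IsBounded R.1 ↔ R = Rinf := by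
  obtain ⟨r, hK⟩ := D.isCompact_image.isBounded.exists_norm_le
  have hne : {z : ℂ | r < ‖z‖}.Nonempty := (Complex.eventually_cocompact_lt_norm r).exists
  obtain ⟨Rinf, hR⟩ := exists_region_of_isPreconnected (D := D) continuous_id
    Function.injective_id (Complex.isPreconnected_lt_norm r) hne
    fun z hz h => (hK z h).not_gt hz
  refine ⟨Rinf, (Complex.eventually_cocompact_lt_norm r).mono hR, fun R => ⟨fun h => ?_, ?_⟩⟩
  · by_contra hne
    refine h ((Metric.isBounded_closedBall (x := (0 : ℂ)) (r := r)).subset fun z hz => ?_)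
    rw [mem_closedBall_zero_iff]
    by_contra! hz'
    exact hne (Region.eq_of_mem hz (hR z hz'))
  · rintro rfl hb
    obtain ⟨C, hC⟩ := hb.exists_norm_le
    obtain ⟨z, h1, h2⟩ := ((Complex.eventually_cocompact_lt_norm r).and
      (Complex.eventually_cocompact_lt_norm C)).exists
    exact (hC z (hR z h1)).not_gt h2

theorem exists_region_infty (D : LinkDiagram l) :
    ∃ Rinf : D.Region ((↑) : ℂ → OnePoint ℂ),
      (∀ᶠ z : ℂ in cocompact ℂ, (z : OnePoint ℂ) ∈ Rinf.1) ∧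
      OnePoint.infty ∈ Rinf.1 := by
  obtain ⟨r, hK⟩ := D.isCompact_image.isBounded.exists_norm_le
  have hinf : OnePoint.infty ∈ (((↑) : ℂ → OnePoint ℂ) '' D.image)ᶜ := by
    rintro ⟨y, -, h⟩
    exact OnePoint.coe_ne_infty y h
  exact ⟨⟨_, OnePoint.infty, hinf, rfl⟩, (Complex.eventually_cocompact_lt_norm r).mono
    fun z hz => OnePoint.mem_connectedComponentIn_infty hK hz, mem_connectedComponentIn hinf⟩

end LinkDiagram

theorem mainTheorem4 {l : ℕ} (D : LinkDiagram l) (hD : Nonempty D.Crossing) :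
    -- the diagram on the plane, with its unbounded region
    (∃ Rinf : D.Region (id : ℂ → ℂ),
      (∀ R : D.Region (id : ℂ → ℂ), ¬ Bornology.IsBounded R.1 ↔ R = Rinf) ∧
      ∃ b : Module.Basis (Option (Fin l)) ℤ (LinearMap.ker (D.Phi (id : ℂ → ℂ))),
        (∀ (i : Fin l) (u : D.Region (id : ℂ → ℂ) → ℤ),
          D.IsStandardKernelSolution id Rinf i u ↔ u = (b (some i)).1) ∧
        (b none).1 = fun _ => 1) ∧
    -- the diagram on the sphere, with the region that contains the infinite point
    (∃ Rinf : D.Region ((↑) : ℂ → OnePoint ℂ),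
      OnePoint.infty ∈ Rinf.1 ∧
      ∃ b : Module.Basis (Option (Fin l)) ℤ (LinearMap.ker (D.Phi ((↑) : ℂ → OnePoint ℂ))),
        (∀ (i : Fin l) (u : D.Region ((↑) : ℂ → OnePoint ℂ) → ℤ),
          D.IsStandardKernelSolution ((↑) : ℂ → OnePoint ℂ) Rinf i u ↔ u = (b (some i)).1) ∧
        (b none).1 = fun _ => 1) := by

  obtain ⟨R₁, h₁, hb⟩ := D.exists_unbounded_region
  obtain ⟨R₂, h₂, hinf⟩ := D.exists_region_infty
  exact ⟨⟨R₁, hb, LinkDiagram.exists_basis LinkDiagram.planeEmbedding_id h₁⟩,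
    ⟨R₂, hinf, LinkDiagram.exists_basis LinkDiagram.planeEmbedding_coe h₂⟩⟩
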